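/- For $p,z\in\mathbb C$ let $D_p(z)$ denote the parabolic cylinder function, the entire function of $z$ given by $$D_p(z)=2^{p/2}e^{-z^2/4}\left\{\frac{\sqrt{\pi}}{\Gamma\left(\frac{1-p}{2}\right)}\,{}_1F_1\left(-\tfrac p2;\tfrac12;\tfrac{z^2}{2}\right)-\frac{\sqrt{2\pi}\,z}{\Gamma\left(-\frac p2\right)}\,{}_1F_1\left(\tfrac{1-p}{2};\tfrac32;\tfrac{z^2}{2}\right)\right\},$$ where $1/\Gamma$ is taken to be $0$ at the poles of $\Gamma$ and ${}_1F_1$ is Kummer's confluent hypergeometric function. Let $\nu>0$ be real. (i) For all real $x>y>0$, $$D_{-\nu}(x)\,D_{-\nu}(-y)=\frac{e^{-(x^2+y^2)/4}}{2\Gamma(\nu)}\int_0^\infty t^{\nu/2-1}(1+t)^{-(\nu+1)/2}\,e^{-\frac12(x^2+y^2)t+xy\sqrt{t(t+1)}}\,dt ,$$ the integral being absolutely convergent. (ii) Let $a,b\in\mathbb C$ with $\operatorname{Re}a>\operatorname{Re}b>0$. Then $$\int_0^\infty t^{\nu/2-1}(1+t)^{-(\nu+1)/2}\,e^{-at+b\sqrt{t(t+1)}}\,dt=2e^{a/2}\,\Gamma(\nu)\,D_{-\nu}\left(\sqrt{a+\sqrt{a^2-b^2}}\right)D_{-\nu}\left(-\sqrt{a-\sqrt{a^2-b^2}}\right),$$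 the integral being absolutely convergent. Here $\sqrt{a^2-b^2}$ and $\sqrt{a+\sqrt{a^2-b^2}}$ are principal square roots, and $\sqrt{a-\sqrt{a^2-b^2}}$ is the square root whose product with $\sqrt{a+\sqrt{a^2-b^2}}$ equals $b$. If $b$ is real, then this last root is also the principal one. -/

import Mathlib

open MeasureTheory Set

/-- Kummer's confluent hypergeometric function `₁F₁(a; b; z) = ∑ₙ (a)ₙ / (b)ₙ * zⁿ / n!`, for `b` not
a non-positive integer. Mathlib's regularized series has `Γ(b + n) = Γ(b) (b)ₙ` in place of `(b)ₙ`. -/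
noncomputable def kummerM (a b z : ℂ) : ℂ :=
  Complex.Gamma b * Complex.regularizedHGFun {a} {b} z

/-- The parabolic cylinder function (Whittaker's notation) of order `p`, an entire function of `z`:
`D_p(z) = 2^(p/2) e^(-z²/4) (√π / Γ((1-p)/2) ₁F₁(-p/2; 1/2; z²/2)`
`- √(2π) z / Γ(-p/2) ₁F₁((1-p)/2; 3/2; z²/2))`.
At the poles of `Γ` Mathlib's value is `0`, so that `1 / Γ` is `0` there, as it should be. -/
noncomputable def parabolicCylinderD (p z : ℂ) : ℂ :=
  (2 : ℂ) ^ (p / 2) * Complex.exp (-z ^ 2 / 4) *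
    (((√Real.pi : ℝ) : ℂ) / Complex.Gamma ((1 - p) / 2) * kummerM (-p / 2) (1 / 2) (z ^ 2 / 2)
      - ((√(2 * Real.pi) : ℝ) : ℂ) * z / Complex.Gamma (-p / 2) *
          kummerM ((1 - p) / 2) (3 / 2) (z ^ 2 / 2))

/-- The integrand `t^(ν/2-1) (1+t)^(-(ν+1)/2) exp(-a t + b √(t (t+1)))`, used for `t > 0`. -/
noncomputable def laplaceIntegrand (ν : ℝ) (a b : ℂ) (t : ℝ) : ℂ :=
  ((t ^ (ν / 2 - 1) * (1 + t) ^ (-(ν + 1) / 2) : ℝ) : ℂ) *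
    Complex.exp (-a * (t : ℂ) + b * ((√(t * (t + 1)) : ℝ) : ℂ))

/-! Up to the factor `exp (-z ^ 2 / 4) / Γ(ν)`, the function `D_{-ν}(z)` is the integral of `s^(ν-1)
e^(-s²/2) e^(-z s)` over `s > 0` (`parabolicCylinderD_neg_eq`). The product formula thus says that,
for fixed `x > 0`, the integral on the right is a constant multiple of the moment `h(y) =
gaussMoment ν y`.

This is proved by a differential equation. Both `h` and the product integral `H` satisfy `u'' = y u'
+ ν u` on `y < x` (`gaussMoment_add_two`, `integral_productIntegrand_second`). Their Wronskian is
therefore a multiple of `e^(y²/2)`. As `y → -∞` it grows at most linearly, so it vanishes and `H = c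
h` (`productIntegral_proportional`). Comparing the asymptotics of `|y|^ν h` and `|y|^ν H` at `-∞`
gives `c`, in `Gamma_mul_productIntegral`.

For complex `a`, `b`, put `A = a + b`, `B = a - b`. The numbers `x = (√A + √B)/√2` and `y = (√A -
√B)/√2` satisfy `x² + y² = 2a` and `x y = b`, so for `A, B > 0` the Laplace transform is the product
formula. Both sides are holomorphic in each of `A` and `B` on the right half-plane, and the identity
theorem, used once in each variable, gives the general case (`integral_laplaceIntegrand`). It
remains to recognise `x` and `y` as the nested roots. -/

open Filter Topology

/-! ### Integral representation of the parabolic cylinder function -/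

/-- The Laplace transform `∫₀^∞ s^(ν-1) e^(-s²/2) e^(-z s) ds`. -/
noncomputable def gaussLaplace (ν : ℝ) (z : ℂ) : ℂ :=
  ∫ s in Ioi (0 : ℝ), ((s ^ (ν - 1) * Real.exp (-s ^ 2 / 2) : ℝ) : ℂ) * Complex.exp (-z * s)

theorem kummerM_hasSum (a b z : ℂ) :
    HasSum (fun n : ℕ => Complex.Gamma b * ((ascPochhammer ℂ n).eval a /
      (n.factorial * Complex.Gamma (b + n))) * z ^ n) (kummerM a b z) := by
  have hr := Complex.radius_regularizedHGFunSeries_eq_top (a := {a}) (b := {b}) (by simp)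
  have := (Complex.regularizedHGFunSeries {a} {b}).hasSum (x := z) (by rw [hr]; simp)
  have h2 := this.mul_left (Complex.Gamma b)
  refine h2.congr_fun fun n => ?_
  simp only [Complex.regularizedHGFunSeries, FormalMultilinearSeries.ofScalars_apply_eq,
    Complex.regularizedHGFunCoeff, Multiset.map_singleton, Multiset.prod_singleton, smul_eq_mul]
  ring

/-- Converts the `(2k)!` of the exponential series into the `k!` and `Γ(1/2 + k)` of Kummer's
series; the next lemma does this for odd indices. -/
theorem four_pow_mul_factorial_mul_Gamma_half_add (k : ℕ) :
    (4 : ℂ) ^ k * k.factorial * Complex.Gamma (1 / 2 + k) =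
      Complex.Gamma (1 / 2) * (2 * k).factorial := by
  induction k with
  | zero => simp
  | succ k ih =>
    have h1 : (1 / 2 : ℂ) + k ≠ 0 := by
      intro h
      have := congrArg Complex.re h
      simp at this
      have h0 : (0 : ℝ) ≤ k := Nat.cast_nonneg k
      linarith
    have h2 : (1 / 2 : ℂ) + (k + 1 : ℕ) = (1 / 2 + k) + 1 := by push_cast; ring
    rw [h2, Complex.Gamma_add_one _ h1, show 2 * (k + 1) = 2 * k + 1 + 1 by ring,
      Nat.factorial_succ, Nat.factorial_succ, Nat.factorial_succ]
    push_cast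
    linear_combination (4 * (k + 1) * (1 / 2 + k) : ℂ) * ih

theorem four_pow_mul_factorial_mul_Gamma_three_halves_add (k : ℕ) :
    (4 : ℂ) ^ k * k.factorial * Complex.Gamma (3 / 2 + k) =
      Complex.Gamma (3 / 2) * (2 * k + 1).factorial := by
  have h1 : (1 / 2 : ℂ) + k ≠ 0 := by
    intro h
    have := congrArg Complex.re h
    simp at this
    have h0 : (0 : ℝ) ≤ k := Nat.cast_nonneg k
    linarith
  have h2 : (3 / 2 : ℂ) + k = (1 / 2 + k) + 1 := by ring
  have h3 : (3 / 2 : ℂ) = 1 / 2 + 1 := by ring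
  rw [h2, h3, Complex.Gamma_add_one _ h1, Complex.Gamma_add_one _ (by norm_num),
    Nat.factorial_succ]
  push_cast
  linear_combination (1 / 2 + k : ℂ) * four_pow_mul_factorial_mul_Gamma_half_add k

theorem Gamma_add_nat_of_pos {μ : ℝ} (hμ : 0 < μ) (k : ℕ) :
    Complex.Gamma (μ + k) = Complex.Gamma μ * (ascPochhammer ℂ k).eval (μ : ℂ) := by
  have hne : ∀ k : ℕ, (μ : ℂ) ≠ -k := by
    intro k h
    have := congrArg Complex.re h
    simp at this
    have h0 : (0 : ℝ) ≤ k := Nat.cast_nonneg k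
    linarith
  rw [← Complex.Gamma_add_nat_div_Gamma_eq _ hne, mul_div_cancel₀]
  exact Complex.Gamma_ne_zero_of_re_pos (by simpa using hμ)

theorem integrableOn_rpow_mul_gauss_mul_exp {ν : ℝ} (hν : 0 < ν) (c : ℝ) :
    IntegrableOn (fun s : ℝ => s ^ (ν - 1) * Real.exp (-s ^ 2 / 2) * Real.exp (c * s))
      (Ioi 0) := by
  have h := (integrableOn_rpow_mul_exp_neg_mul_sq (b := 1 / 4) (by norm_num)
    (s := ν - 1) (by linarith)).mul_const (Real.exp (c ^ 2))
  refine Integrable.mono' h ?_ ?_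
  · exact Measurable.aestronglyMeasurable (by fun_prop)
  · filter_upwards [ae_restrict_mem measurableSet_Ioi] with s hs
    have hs0 : (0 : ℝ) < s := hs
    rw [Real.norm_of_nonneg (by positivity), mul_assoc, mul_assoc, ← Real.exp_add, ← Real.exp_add]
    refine mul_le_mul_of_nonneg_left (Real.exp_le_exp.2 ?_) (by positivity)
    -- Completing the square: `c s ≤ s²/4 + c²`, so half of the Gaussian absorbs the exponential.
    nlinarith [sq_nonneg (s / 2 - c)]

theorem integral_rpow_mul_gauss {μ : ℝ} (hμ : 0 < μ) :
    ∫ s in Ioi (0 : ℝ), s ^ (μ - 1) * Real.exp (-s ^ 2 / 2) =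
      2 ^ (μ / 2) / 2 * Real.Gamma (μ / 2) := by
  have h := integral_rpow_mul_exp_neg_mul_rpow (p := 2) (q := μ - 1) (b := 1 / 2) (by norm_num)
    (by linarith) (by norm_num)
  have e : (1 / 2 : ℝ) ^ (-(μ - 1 + 1) / 2) = 2 ^ (μ / 2) := by
    rw [one_div, Real.inv_rpow (by norm_num), ← Real.rpow_neg (by norm_num)]
    congr 1; ring
  rw [e] at h
  rw [show μ - 1 + 1 = μ by ring] at h
  rw [show (2 : ℝ) ^ (μ / 2) / 2 = 2 ^ (μ / 2) * (1 / 2) by ring, ← h]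
  refine setIntegral_congr_fun measurableSet_Ioi fun s _ => ?_
  simp only [Real.rpow_two]
  congr 2; ring

/-- Expand `exp (-z s)` and integrate term by term, dominated by the series of `exp (‖z‖ s)`; each
term is a Gaussian moment. -/
theorem gaussLaplace_hasSum {ν : ℝ} (hν : 0 < ν) (z : ℂ) :
    HasSum (fun n : ℕ => (-z) ^ n / n.factorial *
      ((2 ^ ((ν + n) / 2) / 2 * Real.Gamma ((ν + n) / 2) : ℝ) : ℂ)) (gaussLaplace ν z) := by
  have key := hasSum_integral_of_dominated_convergence (μ := volume.restrict (Ioi (0 : ℝ)))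
    (F := fun (n : ℕ) (s : ℝ) => ((s ^ (ν - 1) * Real.exp (-s ^ 2 / 2) : ℝ) : ℂ) *
      ((-z * s) ^ n / n.factorial))
    (f := fun s : ℝ => ((s ^ (ν - 1) * Real.exp (-s ^ 2 / 2) : ℝ) : ℂ) * Complex.exp (-z * s))
    (fun (n : ℕ) (s : ℝ) => s ^ (ν - 1) * Real.exp (-s ^ 2 / 2) *
      ((‖z‖ * s) ^ n / n.factorial)) ?_ ?_ ?_ ?_ ?_
  · refine key.congr_fun fun n => ?_
    have hμ : 0 < ν + n := by positivity
    rw [← integral_rpow_mul_gauss hμ, ← integral_complex_ofReal, ← integral_const_mul]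
    refine setIntegral_congr_fun measurableSet_Ioi fun s hs => ?_
    have hs0 : (0 : ℝ) < s := hs
    rw [show ν + n - 1 = (ν - 1) + n by ring, Real.rpow_add hs0, Real.rpow_natCast]
    push_cast
    rw [mul_pow]
    ring
  · intro n
    exact Measurable.aestronglyMeasurable (by fun_prop)
  · intro n
    filter_upwards [ae_restrict_mem measurableSet_Ioi] with s hs
    have hs0 : (0 : ℝ) < s := hs
    rw [norm_mul, Complex.norm_real, Real.norm_of_nonneg (by positivity), norm_div, norm_pow,
      norm_mul, norm_neg, Complex.norm_real, Real.norm_of_nonneg hs0.le, Complex.norm_natCast]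
  · filter_upwards with s
    exact (Real.summable_pow_div_factorial _).mul_left _
  · have h := integrableOn_rpow_mul_gauss_mul_exp hν ‖z‖
    refine h.congr ?_
    filter_upwards with s
    rw [tsum_mul_left, Real.exp_eq_exp_ℝ, NormedSpace.exp_eq_tsum_div]
  · filter_upwards with s
    refine HasSum.mul_left _ ?_
    rw [Complex.exp_eq_exp_ℂ]
    exact NormedSpace.expSeries_div_hasSum_exp (-z * s)

/-- The even and the odd terms of the series in `z` are the two Kummer series, since `Γ((ν + n)/2)`
becomes a rising factorial when `n` advances in steps of two. -/
theorem gaussLaplace_eq_kummerM {ν : ℝ} (hν : 0 < ν) (z : ℂ) :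
    gaussLaplace ν z =
      ((2 ^ (ν / 2) / 2 * Real.Gamma (ν / 2) : ℝ) : ℂ) * kummerM (ν / 2) (1 / 2) (z ^ 2 / 2) -
      ((2 ^ ((ν + 1) / 2) / 2 * Real.Gamma ((ν + 1) / 2) : ℝ) : ℂ) * z *
        kummerM ((ν + 1) / 2) (3 / 2) (z ^ 2 / 2) := by
  have hΓ : ∀ c : ℂ, 0 < c.re → Complex.Gamma c ≠ 0 := fun c hc =>
    Complex.Gamma_ne_zero_of_re_pos hc
  have h1 := (kummerM_hasSum (ν / 2) (1 / 2) (z ^ 2 / 2)).mul_left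
    (((2 ^ (ν / 2) / 2 * Real.Gamma (ν / 2) : ℝ) : ℂ))
  have h2 := (kummerM_hasSum ((ν + 1) / 2) (3 / 2) (z ^ 2 / 2)).mul_left
    (-(((2 ^ ((ν + 1) / 2) / 2 * Real.Gamma ((ν + 1) / 2) : ℝ) : ℂ) * z))
  rw [sub_eq_add_neg, ← neg_mul]
  refine (gaussLaplace_hasSum hν z).unique (HasSum.even_add_odd ?_ ?_)
  · refine h1.congr_fun fun k => ?_
    have g1 := Gamma_add_nat_of_pos (half_pos hν) k
    have g2 := four_pow_mul_factorial_mul_Gamma_half_add k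
    have e1 : (ν + (2 * k : ℕ)) / 2 = ν / 2 + k := by push_cast; ring
    have n1 : Complex.Gamma (1 / 2 + k) ≠ 0 := hΓ _ (by simp; positivity)
    have n2 : (k.factorial : ℂ) ≠ 0 := by exact_mod_cast k.factorial_ne_zero
    have n3 : ((2 * k).factorial : ℂ) ≠ 0 := by exact_mod_cast (2 * k).factorial_ne_zero
    rw [e1, Real.rpow_add (by norm_num), Real.rpow_natCast]
    push_cast at g1 ⊢
    rw [← Complex.Gamma_ofReal, ← Complex.Gamma_ofReal]
    push_cast
    rw [g1, pow_mul, neg_sq, div_pow]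
    rw [show (4 : ℂ) = 2 * 2 by norm_num, mul_pow] at g2
    generalize Complex.Gamma (1 / 2 + k) = G at *
    field_simp
    linear_combination (z ^ (2 * k) * Complex.Gamma (ν / 2) *
      (ascPochhammer ℂ k).eval (ν / 2 : ℂ)) * g2
  · refine h2.congr_fun fun k => ?_
    have g1 := Gamma_add_nat_of_pos (show 0 < (ν + 1) / 2 by positivity) k
    have g2 := four_pow_mul_factorial_mul_Gamma_three_halves_add k
    have e1 : (ν + (2 * k + 1 : ℕ)) / 2 = (ν + 1) / 2 + k := by push_cast; ring
    have n1 : Complex.Gamma (3 / 2 + k) ≠ 0 := hΓ _ (by simp; positivity)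
    have n2 : (k.factorial : ℂ) ≠ 0 := by exact_mod_cast k.factorial_ne_zero
    have n3 : ((2 * k + 1).factorial : ℂ) ≠ 0 := by exact_mod_cast (2 * k + 1).factorial_ne_zero
    rw [e1, Real.rpow_add (by norm_num), Real.rpow_natCast]
    push_cast at g1 ⊢
    rw [← Complex.Gamma_ofReal, ← Complex.Gamma_ofReal]
    push_cast
    rw [g1, pow_succ, pow_mul, neg_sq, div_pow]
    rw [show (4 : ℂ) = 2 * 2 by norm_num, mul_pow] at g2
    generalize Complex.Gamma (3 / 2 + k) = G at *
    field_simp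
    linear_combination (-(z * z ^ (2 * k) * Complex.Gamma ((ν + 1) / 2) *
      (ascPochhammer ℂ k).eval ((ν + 1) / 2 : ℂ))) * g2

/-- Legendre's duplication formula relates `Γ(ν/2)`, `Γ((ν+1)/2)` and `Γ(ν)`, which matches both
coefficients (`r1` and `r2`). -/
theorem parabolicCylinderD_neg_eq {ν : ℝ} (hν : 0 < ν) (z : ℂ) :
    parabolicCylinderD (-(ν : ℂ)) z =
      Complex.exp (-z ^ 2 / 4) / Complex.Gamma ν * gaussLaplace ν z := by
  have d := Real.Gamma_mul_Gamma_add_half (ν / 2)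
  rw [show ν / 2 + 1 / 2 = (ν + 1) / 2 by ring, show 2 * (ν / 2) = ν by ring] at d
  have p1 : 0 < Real.Gamma ν := Real.Gamma_pos_of_pos hν
  have p2 : 0 < Real.Gamma (ν / 2) := Real.Gamma_pos_of_pos (half_pos hν)
  have p3 : 0 < Real.Gamma ((ν + 1) / 2) := Real.Gamma_pos_of_pos (by positivity)
  have q1 : (2 : ℝ) ^ (-ν / 2) * 2 ^ (ν / 2) = 1 := by
    rw [← Real.rpow_add (by norm_num)]; simp [neg_div]
  have q2 : (2 : ℝ) ^ (1 - ν) = 2 * (2 ^ (-ν / 2) * 2 ^ (-ν / 2)) := by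
    rw [← Real.rpow_add (by norm_num), sub_eq_add_neg, Real.rpow_add (by norm_num),
      Real.rpow_one]
    congr 2; ring
  have q3 : (2 : ℝ) ^ ((ν + 1) / 2) = 2 ^ (ν / 2) * √2 := by
    rw [Real.sqrt_eq_rpow, ← Real.rpow_add (by norm_num)]; congr 1; ring
  have r1 : (2 : ℝ) ^ (-ν / 2) * (√Real.pi / Real.Gamma ((ν + 1) / 2)) =
      (2 ^ (ν / 2) / 2 * Real.Gamma (ν / 2)) / Real.Gamma ν := by
    rw [q2] at d
    generalize (2 : ℝ) ^ (-ν / 2) = u at *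
    field_simp
    linear_combination (-2 ^ (ν / 2)) * d - (2 * u * Real.Gamma ν * √Real.pi) * q1
  have r2 : (2 : ℝ) ^ (-ν / 2) * (√(2 * Real.pi) / Real.Gamma (ν / 2)) =
      (2 ^ ((ν + 1) / 2) / 2 * Real.Gamma ((ν + 1) / 2)) / Real.Gamma ν := by
    rw [Real.sqrt_mul (by norm_num), q3]
    rw [q2] at d
    generalize (2 : ℝ) ^ (-ν / 2) = u at *
    field_simp
    linear_combination (-2 ^ (ν / 2)) * d - (2 * u * Real.Gamma ν * √Real.pi) * q1
  have c1 := congrArg (fun r : ℝ => (r : ℂ)) r1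
  have c2 := congrArg (fun r : ℝ => (r : ℂ)) r2
  rw [gaussLaplace_eq_kummerM hν, parabolicCylinderD]
  have t : ((2 : ℝ) ^ (-ν / 2) : ℝ) = ((2 : ℂ) ^ (-(ν : ℂ) / 2)) := by
    rw [Complex.ofReal_cpow (by norm_num)]; push_cast; rfl
  simp only [Complex.ofReal_mul, Complex.ofReal_div, ← Complex.Gamma_ofReal, t] at c1 c2
  simp only [Complex.ofReal_mul, Complex.ofReal_div, ← Complex.Gamma_ofReal]
  push_cast at c1 c2 ⊢
  rw [show (1 - -(ν : ℂ)) / 2 = (ν + 1) / 2 by ring, show -(-(ν : ℂ)) / 2 = ν / 2 by ring]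
  linear_combination Complex.exp (-z ^ 2 / 4) * kummerM (ν / 2) (1 / 2) (z ^ 2 / 2) * c1 -
    Complex.exp (-z ^ 2 / 4) * z * kummerM ((ν + 1) / 2) (3 / 2) (z ^ 2 / 2) * c2

/-! ### Holomorphy of Laplace integrals -/

/-- Differentiation under the integral sign for a two-sided Laplace transform. -/
theorem differentiableAt_integral_mul_exp {α : Type*} [MeasurableSpace α] {μ : Measure α}
    {f : α → ℂ} {X : α → ℝ} (hf : AEStronglyMeasurable f μ) (hX : AEStronglyMeasurable X μ)
    {z₀ : ℂ} {δ : ℝ} (hδ : 0 < δ)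
    (h₁ : Integrable (fun t => ‖f t‖ * Real.exp ((z₀.re + δ) * X t)) μ)
    (h₂ : Integrable (fun t => ‖f t‖ * Real.exp ((z₀.re - δ) * X t)) μ) :
    DifferentiableAt ℂ (fun z : ℂ => ∫ t, f t * Complex.exp (z * X t) ∂μ) z₀ := by
  have hXc : AEStronglyMeasurable (fun t => ((X t : ℝ) : ℂ)) μ :=
    Complex.continuous_ofReal.comp_aestronglyMeasurable hX
  have hm : ∀ z : ℂ, AEStronglyMeasurable (fun t => f t * Complex.exp (z * X t)) μ := fun z =>
    hf.mul (Complex.continuous_exp.comp_aestronglyMeasurable (hXc.const_mul z))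
  have hb : ∀ (r u : ℝ), |r| ≤ δ / 2 →
      Real.exp ((z₀.re + r) * u) ≤
        Real.exp ((z₀.re + δ) * u) + Real.exp ((z₀.re - δ) * u) := by
    intro r u hr
    rw [abs_le] at hr
    rcases le_total 0 u with hu | hu
    · have : Real.exp ((z₀.re + r) * u) ≤ Real.exp ((z₀.re + δ) * u) := by
        gcongr; linarith
      linarith [Real.exp_pos ((z₀.re - δ) * u)]
    · have : Real.exp ((z₀.re + r) * u) ≤ Real.exp ((z₀.re - δ) * u) :=
        Real.exp_le_exp.2 (mul_le_mul_of_nonpos_right (by linarith) hu)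
      linarith [Real.exp_pos ((z₀.re + δ) * u)]
  -- Half of the margin `δ` pays for the factor `|u|` produced by differentiation, the other half
  -- for the variation of `z` in the ball of radius `δ / 2`.
  have hb' : ∀ (r u : ℝ), |r| ≤ δ / 2 → |u| * Real.exp ((z₀.re + r) * u) ≤
        2 / δ * (Real.exp ((z₀.re + δ) * u) + Real.exp ((z₀.re - δ) * u)) := by
    intro r u hr
    rw [abs_le] at hr
    have h1 : |u| ≤ 2 / δ * Real.exp (δ / 2 * |u|) := by
      have := Real.add_one_le_exp (δ / 2 * |u|)
      rw [div_mul_eq_mul_div, le_div_iff₀ hδ]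
      linarith
    have h2 : Real.exp (δ / 2 * |u|) * Real.exp ((z₀.re + r) * u) ≤
        Real.exp ((z₀.re + δ) * u) + Real.exp ((z₀.re - δ) * u) := by
      rw [← Real.exp_add]
      rcases le_total 0 u with hu | hu
      · rw [abs_of_nonneg hu]
        have : Real.exp (δ / 2 * u + (z₀.re + r) * u) ≤ Real.exp ((z₀.re + δ) * u) :=
          Real.exp_le_exp.2 (by nlinarith)
        linarith [Real.exp_pos ((z₀.re - δ) * u)]
      · rw [abs_of_nonpos hu]
        have : Real.exp (δ / 2 * -u + (z₀.re + r) * u) ≤ Real.exp ((z₀.re - δ) * u) :=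
          Real.exp_le_exp.2 (by nlinarith)
        linarith [Real.exp_pos ((z₀.re + δ) * u)]
    calc _ ≤ 2 / δ * Real.exp (δ / 2 * |u|) * Real.exp ((z₀.re + r) * u) := by gcongr
      _ ≤ _ := by rw [mul_assoc]; gcongr
  have hsum : Integrable (fun t => ‖f t‖ * (Real.exp ((z₀.re + δ) * X t) +
      Real.exp ((z₀.re - δ) * X t))) μ := by
    simp only [mul_add]; exact h₁.add h₂
  refine (hasDerivAt_integral_of_dominated_loc_of_deriv_le (μ := μ)
    (F := fun (z : ℂ) t => f t * Complex.exp (z * X t))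
    (F' := fun (z : ℂ) t => f t * (Complex.exp (z * X t) * X t))
    (bound := fun t => 2 / δ * (‖f t‖ * (Real.exp ((z₀.re + δ) * X t) +
      Real.exp ((z₀.re - δ) * X t))))
    (Metric.ball_mem_nhds z₀ (half_pos hδ)) (Filter.Eventually.of_forall hm) ?_ ?_ ?_
    (hsum.const_mul _) ?_).2.differentiableAt
  · refine hsum.mono' (hm z₀) (Filter.Eventually.of_forall fun t => ?_)
    rw [norm_mul, Complex.norm_exp]
    have := hb 0 (X t) (by simpa using (half_pos hδ).le)
    simp only [add_zero] at this
    simpa using mul_le_mul_of_nonneg_left this (norm_nonneg (f t))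
  · exact hf.mul ((Complex.continuous_exp.comp_aestronglyMeasurable (hXc.const_mul z₀)).mul hXc)
  · refine Filter.Eventually.of_forall fun t z hz => ?_
    have hr : |(z - z₀).re| ≤ δ / 2 := by
      rw [Metric.mem_ball, dist_eq_norm] at hz
      exact (Complex.abs_re_le_norm _).trans hz.le
    have := hb' _ (X t) hr
    simp only [Complex.sub_re, add_sub_cancel] at this
    simp only [norm_mul, Complex.norm_exp, Complex.norm_real, Real.norm_eq_abs]
    have h3 := mul_le_mul_of_nonneg_left this (norm_nonneg (f t))
    simp only [Complex.mul_re, Complex.ofReal_re, Complex.ofReal_im, mul_zero, sub_zero]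
    linarith
  · refine Filter.Eventually.of_forall fun t z _ => ?_
    have h := ((hasDerivAt_id z).mul_const ((X t : ℝ) : ℂ)).cexp.const_mul (f t)
    simpa using h

theorem differentiable_gaussLaplace {ν : ℝ} (hν : 0 < ν) : Differentiable ℂ (gaussLaplace ν) := by
  have key : ∀ z₀ : ℂ, DifferentiableAt ℂ (fun z : ℂ => ∫ s in Ioi (0 : ℝ),
      ((s ^ (ν - 1) * Real.exp (-s ^ 2 / 2) : ℝ) : ℂ) * Complex.exp (z * (s : ℝ))) z₀ := by
    intro z₀
    have hi : ∀ c : ℝ, IntegrableOn (fun s : ℝ =>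
        ‖((s ^ (ν - 1) * Real.exp (-s ^ 2 / 2) : ℝ) : ℂ)‖ * Real.exp (c * s)) (Ioi 0) := by
      intro c
      refine (integrableOn_rpow_mul_gauss_mul_exp hν c).congr_fun (fun s hs => ?_)
        measurableSet_Ioi
      have hs0 : (0 : ℝ) < s := hs
      simp only [Complex.norm_real]
      rw [Real.norm_of_nonneg (by positivity)]
    exact differentiableAt_integral_mul_exp (X := fun s => s)
      (Measurable.aestronglyMeasurable (by fun_prop))
      measurable_id.aestronglyMeasurable one_pos (hi _) (hi _)
  intro z₀
  exact (key (-z₀)).comp z₀ differentiableAt_id.neg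

theorem differentiable_parabolicCylinderD_neg {ν : ℝ} (hν : 0 < ν) :
    Differentiable ℂ (parabolicCylinderD (-(ν : ℂ))) := by
  have h : parabolicCylinderD (-(ν : ℂ)) =
      fun z => Complex.exp (-z ^ 2 / 4) / Complex.Gamma ν * gaussLaplace ν z :=
    funext (parabolicCylinderD_neg_eq hν)
  have := differentiable_gaussLaplace hν
  rw [h]
  fun_prop

/-! ### The product integral: bounds and derivatives in `y` -/

/-- The weight `t^(ν/2-1) (1+t)^(-(ν+1)/2)`. -/
noncomputable def productWeight (ν t : ℝ) : ℝ := t ^ (ν / 2 - 1) * (1 + t) ^ (-(ν + 1) / 2)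

/-- The exponent `-(x² + y²) t / 2 + x y √(t (t + 1))`. -/
noncomputable def productExponent (x y t : ℝ) : ℝ :=
  -(x ^ 2 + y ^ 2) * t / 2 + x * y * √(t * (t + 1))

theorem measurable_productWeight (ν : ℝ) : Measurable (productWeight ν) := by
  unfold productWeight; fun_prop

theorem measurable_productExponent (x y : ℝ) : Measurable (productExponent x y) := by
  unfold productExponent; fun_prop

theorem productWeight_nonneg (ν : ℝ) {t : ℝ} (ht : 0 ≤ t) : 0 ≤ productWeight ν t := by
  unfold productWeight; positivity

theorem le_sqrt_mul_add_one {t : ℝ} (ht : 0 ≤ t) : t ≤ √(t * (t + 1)) :=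
  Real.le_sqrt_of_sq_le (by nlinarith)

theorem sqrt_mul_add_one_le {t : ℝ} (ht : 0 ≤ t) : √(t * (t + 1)) ≤ t + 1 / 2 :=
  Real.sqrt_le_iff.2 ⟨by linarith, by nlinarith⟩

/-- Half of the exponential decay absorbs the polynomial: `1 + t ≤ e^(ε t) / ε` for `ε ≤ 1`, and `ε`
is small enough that the `k`-th power costs at most `e^(c t / 2)`. -/
theorem integrableOn_pow_mul_productWeight_mul_exp {ν : ℝ} (hν : 0 < ν) {c : ℝ} (hc : 0 < c)
    (k : ℕ) :
    IntegrableOn (fun t => (1 + t) ^ k * (productWeight ν t * Real.exp (-c * t))) (Ioi 0) := by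
  obtain ⟨ε, hε, hε1, hεc⟩ : ∃ ε : ℝ, 0 < ε ∧ ε ≤ 1 ∧ k * ε ≤ c / 2 := by
    refine ⟨min 1 (c / (2 * (k + 1))), by positivity, min_le_left _ _, ?_⟩
    calc (k : ℝ) * min 1 (c / (2 * (k + 1))) ≤ k * (c / (2 * (k + 1))) := by
          gcongr; exact min_le_right _ _
      _ = (c / 2) * (k / (k + 1)) := by field_simp
      _ ≤ (c / 2) * 1 := by gcongr; rw [div_le_one (by positivity)]; linarith
      _ = c / 2 := mul_one _
  have h := (integrableOn_rpow_mul_exp_neg_mul_rpow (p := 1) (s := ν / 2 - 1) (b := c / 2)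
    (by linarith) one_pos (by linarith)).const_mul ((1 / ε) ^ k)
  refine Integrable.mono' h ?_ ?_
  · have := measurable_productWeight ν
    exact Measurable.aestronglyMeasurable (by fun_prop)
  · filter_upwards [ae_restrict_mem measurableSet_Ioi] with t ht
    have ht0 : (0 : ℝ) < t := ht
    have h1 : (1 + t) ^ k ≤ (1 / ε) ^ k * Real.exp (c / 2 * t) := by
      have h2 : 1 + t ≤ 1 / ε * Real.exp (ε * t) := by
        have := Real.add_one_le_exp (ε * t)
        rw [div_mul_eq_mul_div, one_mul, le_div_iff₀ hε]
        nlinarith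
      calc (1 + t) ^ k ≤ (1 / ε * Real.exp (ε * t)) ^ k := by gcongr
        _ = (1 / ε) ^ k * Real.exp (k * ε * t) := by
          rw [mul_pow, ← Real.exp_nat_mul, mul_assoc]
        _ ≤ _ := by gcongr
    have h3 : productWeight ν t ≤ t ^ (ν / 2 - 1) := by
      unfold productWeight
      exact mul_le_of_le_one_right (by positivity)
        (Real.rpow_le_one_of_one_le_of_nonpos (by linarith) (by linarith))
    have h0 := productWeight_nonneg ν ht0.le
    rw [Real.norm_of_nonneg (by positivity), Real.rpow_one]
    calc _ ≤ ((1 / ε) ^ k * Real.exp (c / 2 * t)) * (t ^ (ν / 2 - 1) * Real.exp (-c * t)) := by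
          gcongr
      _ = (1 / ε) ^ k * (t ^ (ν / 2 - 1) * (Real.exp (c / 2 * t) * Real.exp (-c * t))) := by ring
      _ = _ := by rw [← Real.exp_add]; congr 3; ring

/-- Since `√(t (t + 1))` lies between `t` and `t + 1/2`, replacing it by `t` changes the exponent
boundedly and completes a square. This is why the integral converges for every `y < x`, negative `y`
included. -/
theorem productExponent_le (x y : ℝ) {t : ℝ} (ht : 0 ≤ t) :
    productExponent x y t ≤ -(x - y) ^ 2 * t / 2 + |x * y| / 2 := by
  unfold productExponent
  have h1 : x * y * (√(t * (t + 1)) - t) ≤ |x * y| * (1 / 2) :=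
    mul_le_mul (le_abs_self _) (by linarith [sqrt_mul_add_one_le ht])
      (by linarith [le_sqrt_mul_add_one ht]) (abs_nonneg _)
  nlinarith

/-- The bound is uniform over `y` in a bounded set at distance at least `ε` below `x`, as domination
under the integral sign requires. -/
theorem norm_productIntegrand_le (ν : ℝ) {x y ε Y M q t : ℝ} {k : ℕ} (hε : 0 < ε)
    (hεy : ε ≤ x - y) (hY : |y| ≤ Y) (ht : 0 < t) (hq : |q| ≤ M * (1 + t) ^ k) :
    ‖productWeight ν t * (q * Real.exp (productExponent x y t))‖ ≤
      M * Real.exp (|x| * Y / 2) *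
        ((1 + t) ^ k * (productWeight ν t * Real.exp (-(ε ^ 2 / 2) * t))) := by
  have h0 := productWeight_nonneg ν ht.le
  have h1 : productExponent x y t ≤ |x| * Y / 2 + -(ε ^ 2 / 2) * t := by
    have a1 := productExponent_le x y ht.le
    have a2 : |x * y| ≤ |x| * Y := by rw [abs_mul]; gcongr
    have a3 : ε ^ 2 ≤ (x - y) ^ 2 := by gcongr
    nlinarith
  have h2 := Real.exp_le_exp.2 h1
  rw [Real.exp_add] at h2
  have hM : 0 ≤ M * (1 + t) ^ k := (abs_nonneg q).trans hq
  rw [norm_mul, norm_mul, Real.norm_of_nonneg h0, Real.norm_of_nonneg (Real.exp_pos _).le,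
    Real.norm_eq_abs]
  calc _ ≤ productWeight ν t * ((M * (1 + t) ^ k) *
        (Real.exp (|x| * Y / 2) * Real.exp (-(ε ^ 2 / 2) * t))) := by gcongr
    _ = _ := by ring

theorem integrableOn_productIntegrand {ν : ℝ} (hν : 0 < ν) {x y M : ℝ} {k : ℕ} (hxy : y < x)
    {q : ℝ → ℝ} (hqm : Measurable q) (hq : ∀ t, 0 < t → |q t| ≤ M * (1 + t) ^ k) :
    IntegrableOn (fun t => productWeight ν t * (q t * Real.exp (productExponent x y t)))
      (Ioi 0) := by
  have hε : 0 < x - y := by linarith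
  have h := (integrableOn_pow_mul_productWeight_mul_exp hν
    (show 0 < (x - y) ^ 2 / 2 by positivity) k).const_mul (M * Real.exp (|x| * |y| / 2))
  refine Integrable.mono' h ?_ ?_
  · have := measurable_productWeight ν
    have := measurable_productExponent x y
    exact Measurable.aestronglyMeasurable (by fun_prop)
  · filter_upwards [ae_restrict_mem measurableSet_Ioi] with t ht
    exact norm_productIntegrand_le ν hε le_rfl le_rfl ht (hq t ht)

theorem hasDerivAt_integral_productIntegrand {ν : ℝ} (hν : 0 < ν) {x y₀ M : ℝ} {k : ℕ}
    (hxy : y₀ < x) {q q' : ℝ → ℝ → ℝ} (hqm : ∀ y, Measurable (q y))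
    (hqm' : ∀ y, Measurable (q' y))
    (hq : ∀ t, 0 < t → |q y₀ t| ≤ M * (1 + t) ^ k)
    (hq' : ∀ y t, |y| ≤ |y₀| + 1 → 0 < t → |q' y t| ≤ M * (1 + t) ^ k)
    (hd : ∀ y t, 0 < t → HasDerivAt (fun y => q y t * Real.exp (productExponent x y t))
      (q' y t * Real.exp (productExponent x y t)) y) :
    HasDerivAt
      (fun y => ∫ t in Ioi 0, productWeight ν t * (q y t * Real.exp (productExponent x y t)))
      (∫ t in Ioi 0, productWeight ν t * (q' y₀ t * Real.exp (productExponent x y₀ t))) y₀ := by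
  have hmw := measurable_productWeight ν
  have hme := measurable_productExponent x
  -- Half the gap: every `y` within `ε` of `y₀` still stays `ε` below `x`.
  set ε := (x - y₀) / 2 with hεd
  have hε : 0 < ε := by linarith
  refine (hasDerivAt_integral_of_dominated_loc_of_deriv_le
    (F := fun y t => productWeight ν t * (q y t * Real.exp (productExponent x y t)))
    (F' := fun y t => productWeight ν t * (q' y t * Real.exp (productExponent x y t)))
    (Metric.ball_mem_nhds y₀ (lt_min one_pos hε)) ?_ ?_ ?_
    (bound := fun t => M * Real.exp (|x| * (|y₀| + 1) / 2) *
        ((1 + t) ^ k * (productWeight ν t * Real.exp (-(ε ^ 2 / 2) * t)))) ?_ ?_ ?_).2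
  · exact Filter.Eventually.of_forall fun y => Measurable.aestronglyMeasurable
      (hmw.mul ((hqm y).mul (hme y).exp))
  · exact integrableOn_productIntegrand hν hxy (hqm y₀) hq
  · exact Measurable.aestronglyMeasurable (hmw.mul ((hqm' y₀).mul (hme y₀).exp))
  · filter_upwards [ae_restrict_mem measurableSet_Ioi] with t ht y hy
    rw [Metric.mem_ball, Real.dist_eq] at hy
    have hy1 := hy.trans_le (min_le_left _ _)
    have hy2 := hy.trans_le (min_le_right _ _)
    have hy3 : |y| ≤ |y₀| + 1 := by
      have := abs_add_le (y - y₀) y₀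
      rw [sub_add_cancel] at this
      linarith
    rw [abs_lt] at hy2
    exact norm_productIntegrand_le ν hε (by linarith [hy2.2]) hy3 ht (hq' y t hy3 ht)
  · exact (integrableOn_pow_mul_productWeight_mul_exp hν (by positivity) k).const_mul _
  · filter_upwards [ae_restrict_mem measurableSet_Ioi] with t ht y _
    exact (hd y t ht).const_mul _

theorem hasDerivAt_productExponent_right (x y t : ℝ) :
    HasDerivAt (fun y => productExponent x y t) (x * √(t * (t + 1)) - y * t) y := by
  unfold productExponent
  have h := ((((hasDerivAt_id y).pow 2).const_add (x ^ 2)).neg.mul_const t).div_const 2 |>.add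
    (((hasDerivAt_id y).const_mul x).mul_const √(t * (t + 1)))
  refine h.congr_deriv ?_
  simp
  ring

theorem abs_mul_sqrt_sub_le (x y : ℝ) {t : ℝ} (ht : 0 < t) :
    |x * √(t * (t + 1)) - y * t| ≤ (|x| + |y|) * (1 + t) := by
  have h1 := sqrt_mul_add_one_le ht.le
  calc |x * √(t * (t + 1)) - y * t| ≤ |x * √(t * (t + 1))| + |y * t| := abs_sub _ _
    _ = |x| * √(t * (t + 1)) + |y| * t := by
      rw [abs_mul, abs_mul, abs_of_nonneg (Real.sqrt_nonneg _), abs_of_pos ht]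
    _ ≤ |x| * (1 + t) + |y| * (1 + t) := by gcongr <;> linarith
    _ = _ := by ring

/-- The integral on the right of the product formula. -/
noncomputable def productIntegral (ν x y : ℝ) : ℝ :=
  ∫ t in Ioi 0, productWeight ν t * Real.exp (productExponent x y t)

/-- The derivative of `productIntegral` in its last variable. -/
noncomputable def productIntegralDeriv (ν x y : ℝ) : ℝ :=
  ∫ t in Ioi 0, productWeight ν t *
    ((x * √(t * (t + 1)) - y * t) * Real.exp (productExponent x y t))

theorem hasDerivAt_productIntegral {ν : ℝ} (hν : 0 < ν) {x y : ℝ} (hxy : y < x) :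
    HasDerivAt (productIntegral ν x) (productIntegralDeriv ν x y) y := by
  have h := hasDerivAt_integral_productIntegrand hν (x := x) (y₀ := y) (k := 1)
    (M := |x| + (|y| + 1) + 1) hxy (q := fun _ _ => 1)
    (q' := fun y t => x * √(t * (t + 1)) - y * t) (fun _ => by fun_prop) (fun _ => by fun_prop)
    ?_ ?_ ?_
  · simp only [one_mul] at h
    exact h
  · intro t ht
    rw [abs_one, pow_one]
    nlinarith [abs_nonneg x, abs_nonneg y]
  · intro z t hz ht
    refine (abs_mul_sqrt_sub_le x z ht).trans ?_
    rw [pow_one]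
    exact mul_le_mul_of_nonneg_right (by linarith) (by linarith)
  · intro z t _
    simpa [mul_comm] using (hasDerivAt_productExponent_right x z t).exp

theorem sq_abs_mul_sqrt_sub_sub_le (x y : ℝ) {t : ℝ} (ht : 0 < t) :
    |(x * √(t * (t + 1)) - y * t) ^ 2 - t| ≤ ((|x| + |y|) ^ 2 + 1) * (1 + t) ^ 2 := by
  have h := abs_mul_sqrt_sub_le x y ht
  calc _ ≤ |(x * √(t * (t + 1)) - y * t) ^ 2| + |t| := abs_sub _ _
    _ = |x * √(t * (t + 1)) - y * t| ^ 2 + t := by rw [abs_pow, abs_of_pos ht]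
    _ ≤ ((|x| + |y|) * (1 + t)) ^ 2 + (1 + t) ^ 2 := by gcongr; nlinarith
    _ = _ := by ring

theorem hasDerivAt_productIntegralDeriv {ν : ℝ} (hν : 0 < ν) {x y : ℝ} (hxy : y < x) :
    HasDerivAt (productIntegralDeriv ν x) (∫ t in Ioi 0, productWeight ν t *
      (((x * √(t * (t + 1)) - y * t) ^ 2 - t) * Real.exp (productExponent x y t))) y := by
  refine hasDerivAt_integral_productIntegrand hν (x := x) (y₀ := y) (k := 2)
    (M := (|x| + (|y| + 1)) ^ 2 + 1) hxy (q := fun y t => x * √(t * (t + 1)) - y * t)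
    (q' := fun y t => (x * √(t * (t + 1)) - y * t) ^ 2 - t) (fun _ => by fun_prop)
    (fun _ => by fun_prop) ?_ ?_ ?_
  · intro t ht
    refine (abs_mul_sqrt_sub_le x y ht).trans ?_
    have h1 : (1 + t) ≤ (1 + t) ^ 2 := by nlinarith
    have h2 : |x| + |y| ≤ (|x| + (|y| + 1)) ^ 2 + 1 := by
      nlinarith [abs_nonneg x, abs_nonneg y]
    gcongr
  · intro z t hz ht
    refine (sq_abs_mul_sqrt_sub_sub_le x z ht).trans ?_
    gcongr
  · intro z t _
    have h1 := (hasDerivAt_productExponent_right x z t).exp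
    have h2 := ((hasDerivAt_id z).mul_const t).const_sub (x * √(t * (t + 1)))
    refine (h2.mul h1).congr_deriv ?_
    simp
    ring

/-! ### The differential equation `u'' = y u' + ν u` -/

/-- The integrand of `H'' - y H' - ν H` is `-2` times the `t`-derivative of `t (t + 1)` times the
integrand of `H`. That function, `G` below, vanishes at both ends. -/
theorem integral_productIntegrand_second {ν : ℝ} (hν : 0 < ν) {x y : ℝ} (hxy : y < x) :
    (∫ t in Ioi 0, productWeight ν t *
      (((x * √(t * (t + 1)) - y * t) ^ 2 - t) * Real.exp (productExponent x y t))) =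
    y * productIntegralDeriv ν x y + ν * productIntegral ν x y := by
  set q := fun t : ℝ => ν / 2 + t / 2 - (x ^ 2 + y ^ 2) * (t * (t + 1)) / 2 +
    x * y * (2 * t + 1) * √(t * (t + 1)) / 2 with hq
  set G := fun t : ℝ => t ^ (ν / 2) * (1 + t) ^ ((1 - ν) / 2) * Real.exp (productExponent x y t)
    with hG
  have hGe : ∀ t, 0 < t → G t =
      productWeight ν t * (t * (t + 1) * Real.exp (productExponent x y t)) := by
    intro t ht
    simp only [hG, productWeight]
    rw [show ν / 2 = (ν / 2 - 1) + 1 by ring, Real.rpow_add ht,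
      show (1 - ν) / 2 = -(ν + 1) / 2 + 1 by ring, Real.rpow_add (by linarith), Real.rpow_one,
      Real.rpow_one]
    ring_nf
  have hqi : IntegrableOn (fun t => productWeight ν t *
      (q t * Real.exp (productExponent x y t))) (Ioi 0) := by
    refine integrableOn_productIntegrand hν hxy (k := 2)
      (M := ν / 2 + 1 + (x ^ 2 + y ^ 2) + |x * y|) (by fun_prop) ?_
    intro t ht
    have hR0 := Real.sqrt_nonneg (t * (t + 1))
    have hR1 := sqrt_mul_add_one_le ht.le
    have b1 : ν / 2 + t / 2 ≤ (ν / 2 + 1) * (1 + t) ^ 2 := by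
      nlinarith [mul_pos hν ht, mul_pos hν (mul_pos ht ht), mul_pos ht ht]
    have b2 : (x ^ 2 + y ^ 2) * (t * (t + 1)) / 2 ≤ (x ^ 2 + y ^ 2) * (1 + t) ^ 2 := by
      rw [mul_div_assoc]; gcongr; nlinarith
    have b3 : |x * y * (2 * t + 1) * √(t * (t + 1)) / 2| ≤ |x * y| * (1 + t) ^ 2 := by
      rw [mul_assoc, mul_div_assoc, abs_mul, abs_of_nonneg (a := (2 * t + 1) * _ / 2)
        (by positivity)]
      gcongr
      nlinarith
    have b4 : 0 ≤ (x ^ 2 + y ^ 2) * (t * (t + 1)) / 2 := by positivity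
    have b5 : 0 ≤ ν / 2 + t / 2 := by positivity
    rw [abs_le] at b3 ⊢
    simp only [hq]
    constructor <;> nlinarith [b3.1, b3.2]
  have hGi : IntegrableOn G (Ioi 0) := by
    refine (integrableOn_productIntegrand hν hxy (k := 2) (M := 1) (q := fun t => t * (t + 1))
      (by fun_prop) fun t ht => ?_).congr_fun (fun t ht => (hGe t ht).symm) measurableSet_Ioi
    rw [abs_of_nonneg (by positivity)]; nlinarith
  have hGd : ∀ t ∈ Ioi (0 : ℝ), HasDerivAt G (productWeight ν t *
      (q t * Real.exp (productExponent x y t))) t := by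
    intro t ht
    have ht0 : (0 : ℝ) < t := ht
    have hp : 0 < t * (t + 1) := by positivity
    have hR : 0 < √(t * (t + 1)) := Real.sqrt_pos.2 hp
    have hR2 : √(t * (t + 1)) ^ 2 = t * (t + 1) := Real.sq_sqrt hp.le
    have d1 : HasDerivAt (fun t : ℝ => t ^ (ν / 2)) (ν / 2 * t ^ (ν / 2 - 1)) t :=
      Real.hasDerivAt_rpow_const (Or.inl ht0.ne')
    have d2 : HasDerivAt (fun t : ℝ => (1 + t) ^ ((1 - ν) / 2))
        (1 * ((1 - ν) / 2) * (1 + t) ^ ((1 - ν) / 2 - 1)) t :=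
      ((hasDerivAt_id t).const_add 1).rpow_const (Or.inl (by simp; linarith))
    have d3 : HasDerivAt (fun t : ℝ => √(t * (t + 1)))
        ((1 * (t + 1) + t * 1) / (2 * √(t * (t + 1)))) t :=
      ((hasDerivAt_id t).mul ((hasDerivAt_id t).add_const 1)).sqrt hp.ne'
    have d4 : HasDerivAt (productExponent x y)
        (-(x ^ 2 + y ^ 2) * 1 / 2 + x * y * ((1 * (t + 1) + t * 1) / (2 * √(t * (t + 1))))) t :=
      (((hasDerivAt_id t).const_mul (-(x ^ 2 + y ^ 2))).div_const 2).add (d3.const_mul (x * y))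
    refine ((d1.mul d2).mul d4.exp).congr_deriv ?_
    simp only [hq, productWeight, Pi.mul_apply]
    rw [show (1 - ν) / 2 - 1 = -(ν + 1) / 2 by ring,
      show (1 - ν) / 2 = -(ν + 1) / 2 + 1 by ring, Real.rpow_add (by linarith : 0 < 1 + t),
      show ν / 2 = (ν / 2 - 1) + 1 by ring, Real.rpow_add ht0, add_sub_cancel_right,
      Real.rpow_one, Real.rpow_one]
    generalize t ^ (ν / 2 - 1) = T
    generalize (1 + t) ^ (-(ν + 1) / 2) = U
    generalize Real.exp (productExponent x y t) = E
    generalize √(t * (t + 1)) = R at *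
    field_simp
    linear_combination (-(T * U * E) * x * y * (2 * t + 1)) * hR2
  have hG0 : ContinuousWithinAt G (Ici 0) 0 := by
    refine ContinuousAt.continuousWithinAt ?_
    refine ((Real.continuousAt_rpow_const _ _ (Or.inr (by positivity))).mul
      (ContinuousAt.rpow_const (by fun_prop) (Or.inl (by norm_num)))).mul ?_
    unfold productExponent
    fun_prop
  -- `G` tends to `0` at infinity because both it and its derivative are integrable.
  have hI := integral_Ioi_of_hasDerivAt_of_tendsto hG0 hGd hqi
    (tendsto_zero_of_hasDerivAt_of_integrableOn_Ioi hGd hqi hGi)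
  have hG00 : G 0 = 0 := by simp [hG, Real.zero_rpow (half_pos hν).ne']
  rw [hG00, sub_zero] at hI
  have i1 : IntegrableOn (fun t => productWeight ν t *
      ((x * √(t * (t + 1)) - y * t) * Real.exp (productExponent x y t))) (Ioi 0) :=
    integrableOn_productIntegrand hν hxy (k := 1) (M := |x| + |y|) (by fun_prop)
      fun t ht => by simpa using abs_mul_sqrt_sub_le x y ht
  have i0 : IntegrableOn (fun t => productWeight ν t *
      Real.exp (productExponent x y t)) (Ioi 0) := by
    simpa using integrableOn_productIntegrand hν hxy (k := 0) (M := 1) (q := fun _ => 1)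
      (by fun_prop) (by simp)
  have : (∫ t in Ioi 0, productWeight ν t *
      (((x * √(t * (t + 1)) - y * t) ^ 2 - t) * Real.exp (productExponent x y t))) =
      ∫ t in Ioi 0, (y * (productWeight ν t *
        ((x * √(t * (t + 1)) - y * t) * Real.exp (productExponent x y t))) +
      ν * (productWeight ν t * Real.exp (productExponent x y t)) -
      2 * (productWeight ν t * (q t * Real.exp (productExponent x y t)))) := by
    refine setIntegral_congr_fun measurableSet_Ioi fun t ht => ?_
    have ht0 : (0 : ℝ) < t := ht
    have hR2 : √(t * (t + 1)) ^ 2 = t * (t + 1) := Real.sq_sqrt (by positivity)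
    simp only [hq]
    linear_combination (productWeight ν t * Real.exp (productExponent x y t) * x ^ 2) * hR2
  have i2 : IntegrableOn (fun t => y * (productWeight ν t *
        ((x * √(t * (t + 1)) - y * t) * Real.exp (productExponent x y t))) +
      ν * (productWeight ν t * Real.exp (productExponent x y t))) (Ioi 0) :=
    (i1.const_mul y).add (i0.const_mul ν)
  rw [this, integral_sub i2 (hqi.const_mul 2), integral_add (i1.const_mul y) (i0.const_mul ν),
    integral_const_mul, integral_const_mul, integral_const_mul, hI]
  simp [productIntegralDeriv, productIntegral]

/-- The integral `∫₀^∞ s^(μ-1) e^(-s²/2) e^(y s) ds` for real `y`. -/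
noncomputable def gaussMoment (μ y : ℝ) : ℝ :=
  ∫ s in Ioi 0, s ^ (μ - 1) * Real.exp (-s ^ 2 / 2) * Real.exp (y * s)

theorem gaussLaplace_ofReal (ν x : ℝ) : gaussLaplace ν (x : ℂ) = (gaussMoment ν (-x) : ℂ) := by
  rw [gaussLaplace, gaussMoment, ← integral_complex_ofReal]
  refine setIntegral_congr_fun measurableSet_Ioi fun s _ => ?_
  push_cast
  rfl

theorem gaussMoment_pos {μ : ℝ} (hμ : 0 < μ) (y : ℝ) : 0 < gaussMoment μ y := by
  refine (setIntegral_pos_iff_support_of_nonneg_ae ?_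
    (integrableOn_rpow_mul_gauss_mul_exp hμ y)).2 ?_
  · filter_upwards [ae_restrict_mem measurableSet_Ioi] with s hs
    have hs0 : (0 : ℝ) < s := hs
    simp only [Pi.zero_apply]
    positivity
  · rw [inter_eq_right.2]
    · simp
    · intro s hs
      have hs0 : (0 : ℝ) < s := hs
      rw [Function.mem_support]
      positivity

theorem gaussMoment_le {μ : ℝ} (hμ : 0 < μ) {y : ℝ} (hy : y ≤ 0) :
    gaussMoment μ y ≤ gaussMoment μ 0 := by
  refine setIntegral_mono_on (integrableOn_rpow_mul_gauss_mul_exp hμ y)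
    (integrableOn_rpow_mul_gauss_mul_exp hμ 0) measurableSet_Ioi fun s hs => ?_
  have hs0 : (0 : ℝ) < s := hs
  gcongr

theorem hasDerivAt_gaussMoment {μ : ℝ} (hμ : 0 < μ) (y₀ : ℝ) :
    HasDerivAt (gaussMoment μ) (gaussMoment (μ + 1) y₀) y₀ := by
  refine (hasDerivAt_integral_of_dominated_loc_of_deriv_le
    (F := fun y s => s ^ (μ - 1) * Real.exp (-s ^ 2 / 2) * Real.exp (y * s))
    (F' := fun y s => s ^ (μ + 1 - 1) * Real.exp (-s ^ 2 / 2) * Real.exp (y * s))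
    (Metric.ball_mem_nhds y₀ one_pos) ?_ ?_ ?_
    (bound := fun s => s ^ (μ + 1 - 1) * Real.exp (-s ^ 2 / 2) * Real.exp ((y₀ + 1) * s))
    ?_ ?_ ?_).2
  · exact Eventually.of_forall fun y => Measurable.aestronglyMeasurable (by fun_prop)
  · exact integrableOn_rpow_mul_gauss_mul_exp hμ y₀
  · exact Measurable.aestronglyMeasurable (by fun_prop)
  · filter_upwards [ae_restrict_mem measurableSet_Ioi] with s hs y hy
    have hs0 : (0 : ℝ) < s := hs
    rw [Metric.mem_ball, Real.dist_eq, abs_lt] at hy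
    rw [Real.norm_of_nonneg (by positivity)]
    gcongr
    linarith [hy.2]
  · exact integrableOn_rpow_mul_gauss_mul_exp (by linarith) _
  · filter_upwards [ae_restrict_mem measurableSet_Ioi] with s hs y _
    have hs0 : (0 : ℝ) < s := hs
    refine (((hasDerivAt_id y).mul_const s).exp.const_mul
      (s ^ (μ - 1) * Real.exp (-s ^ 2 / 2))).congr_deriv ?_
    rw [show μ + 1 - 1 = (μ - 1) + 1 by ring, Real.rpow_add hs0, Real.rpow_one]
    simp only [id]
    ring

/-- Integrate the derivative of `s^ν e^(-s²/2 + y s)`, which vanishes at both ends. As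
differentiation in `y` raises `μ` by one, this is the equation `h'' = y h' + ν h`. -/
theorem gaussMoment_add_two {ν : ℝ} (hν : 0 < ν) (y : ℝ) :
    gaussMoment (ν + 2) y = y * gaussMoment (ν + 1) y + ν * gaussMoment ν y := by
  have i0 := integrableOn_rpow_mul_gauss_mul_exp hν y
  have i1 := integrableOn_rpow_mul_gauss_mul_exp (show 0 < ν + 1 by linarith) y
  have i2 := integrableOn_rpow_mul_gauss_mul_exp (show 0 < ν + 2 by linarith) y
  set G := fun s : ℝ => s ^ ν * Real.exp (-s ^ 2 / 2) * Real.exp (y * s) with hG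
  have hGi : IntegrableOn G (Ioi 0) := by simpa [hG] using i1
  have i3 : IntegrableOn (fun s => ν * (s ^ (ν - 1) * Real.exp (-s ^ 2 / 2) * Real.exp (y * s)) +
      y * (s ^ (ν + 1 - 1) * Real.exp (-s ^ 2 / 2) * Real.exp (y * s))) (Ioi 0) :=
    (i0.const_mul ν).add (i1.const_mul y)
  have hGd : ∀ s ∈ Ioi (0 : ℝ), HasDerivAt G
      (ν * (s ^ (ν - 1) * Real.exp (-s ^ 2 / 2) * Real.exp (y * s)) +
      y * (s ^ (ν + 1 - 1) * Real.exp (-s ^ 2 / 2) * Real.exp (y * s)) -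
      s ^ (ν + 2 - 1) * Real.exp (-s ^ 2 / 2) * Real.exp (y * s)) s := by
    intro s hs
    have hs0 : (0 : ℝ) < s := hs
    have d1 : HasDerivAt (fun s : ℝ => s ^ ν) (ν * s ^ (ν - 1)) s :=
      Real.hasDerivAt_rpow_const (Or.inl hs0.ne')
    have d2 := (((hasDerivAt_id s).pow 2).neg.div_const 2).exp
    have d3 := ((hasDerivAt_id s).const_mul y).exp
    refine ((d1.mul d2).mul d3).congr_deriv ?_
    have e : s ^ ν = s ^ (ν - 1) * s := by rw [← Real.rpow_add_one hs0.ne', sub_add_cancel]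
    rw [show ν + 2 - 1 = ν + 1 by ring, show ν + 1 - 1 = ν by ring, Real.rpow_add_one hs0.ne']
    simp
    rw [e]
    ring
  have hG0 : ContinuousWithinAt G (Ici 0) 0 := by
    refine ContinuousAt.continuousWithinAt ?_
    exact ((Real.continuousAt_rpow_const _ _ (Or.inr hν.le)).mul (by fun_prop)).mul (by fun_prop)
  have hI := integral_Ioi_of_hasDerivAt_of_tendsto hG0 hGd (i3.sub i2)
    (tendsto_zero_of_hasDerivAt_of_integrableOn_Ioi hGd (i3.sub i2) hGi)
  have hG00 : G 0 = 0 := by simp [hG, Real.zero_rpow hν.ne']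
  rw [hG00, sub_zero, integral_sub i3 i2, integral_add (i0.const_mul ν) (i1.const_mul y),
    integral_const_mul, integral_const_mul] at hI
  simp only [gaussMoment]
  linarith

/-! ### Vanishing of the Wronskian -/

/-- For `y ≤ 0` the cross term of the exponent is nonpositive, so `e^(-x² t / 2)` dominates
uniformly in `y`; the derivative only brings down a factor linear in `|y|`. -/
theorem abs_productIntegral_le {ν : ℝ} (hν : 0 < ν) {x : ℝ} (hx : 0 < x) :
    ∃ C : ℝ, ∀ y : ℝ, y ≤ 0 → |productIntegral ν x y| ≤ C ∧
      |productIntegralDeriv ν x y| ≤ C * (1 + |y|) := by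
  have hx2 : 0 < x ^ 2 / 2 := by positivity
  have i0 := integrableOn_pow_mul_productWeight_mul_exp hν hx2 0
  have i1 := integrableOn_pow_mul_productWeight_mul_exp hν hx2 1
  set C₀ := ∫ t in Ioi 0, (1 + t) ^ 0 * (productWeight ν t * Real.exp (-(x ^ 2 / 2) * t))
  set C₁ := ∫ t in Ioi 0, (1 + t) ^ 1 * (productWeight ν t * Real.exp (-(x ^ 2 / 2) * t))
  have hC₁ : 0 ≤ C₁ := setIntegral_nonneg measurableSet_Ioi fun t ht => by
    have ht0 : (0 : ℝ) < t := ht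
    have := productWeight_nonneg ν ht0.le
    positivity
  have hC₀ : 0 ≤ C₀ := setIntegral_nonneg measurableSet_Ioi fun t ht => by
    have ht0 : (0 : ℝ) < t := ht
    have := productWeight_nonneg ν ht0.le
    positivity
  have hK : ∀ y t : ℝ, y ≤ 0 → 0 < t →
      productExponent x y t ≤ -(x ^ 2 / 2) * t := by
    intro y t hy ht
    unfold productExponent
    have h1 : x * y * √(t * (t + 1)) ≤ 0 :=
      mul_nonpos_of_nonpos_of_nonneg (mul_nonpos_of_nonneg_of_nonpos hx.le hy)
        (Real.sqrt_nonneg _)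
    have h2 : 0 ≤ y ^ 2 * t := by positivity
    nlinarith
  refine ⟨C₀ + (x + 1) * C₁, fun y hy => ⟨?_, ?_⟩⟩
  · rw [← Real.norm_eq_abs, productIntegral]
    refine (norm_integral_le_of_norm_le i0 ?_).trans (by nlinarith : C₀ ≤ C₀ + (x + 1) * C₁)
    filter_upwards [ae_restrict_mem measurableSet_Ioi] with t ht
    have ht0 : (0 : ℝ) < t := ht
    have h0 := productWeight_nonneg ν ht0.le
    rw [Real.norm_of_nonneg (by positivity), pow_zero, one_mul]
    gcongr
    exact hK y t hy ht0
  · rw [← Real.norm_eq_abs, productIntegralDeriv]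
    refine (norm_integral_le_of_norm_le (i1.const_mul (x + |y|)) ?_).trans ?_
    · filter_upwards [ae_restrict_mem measurableSet_Ioi] with t ht
      have ht0 : (0 : ℝ) < t := ht
      have h0 := productWeight_nonneg ν ht0.le
      have h1 := abs_mul_sqrt_sub_le x y ht0
      rw [abs_of_pos hx] at h1
      rw [norm_mul, norm_mul, Real.norm_of_nonneg h0, Real.norm_of_nonneg (Real.exp_pos _).le,
        Real.norm_eq_abs, pow_one]
      calc _ ≤ productWeight ν t * (((x + |y|) * (1 + t)) * Real.exp (-(x ^ 2 / 2) * t)) := by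
            gcongr
            exact hK y t hy ht0
        _ = _ := by ring
    · rw [integral_const_mul]
      change (x + |y|) * C₁ ≤ _
      nlinarith [abs_nonneg y, mul_nonneg (abs_nonneg y) hC₁, mul_nonneg (abs_nonneg y) hC₀,
        mul_nonneg hx.le hC₁, mul_nonneg (mul_nonneg hx.le hC₁) (abs_nonneg y)]

theorem eq_zero_of_mul_exp_sq_le {c C : ℝ}
    (h : ∀ y : ℝ, y ≤ 0 → |c * Real.exp (y ^ 2 / 2)| ≤ C * (1 + |y|)) : c = 0 := by
  by_contra hc
  have hc' : 0 < |c| := abs_pos.2 hc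
  -- At `y = -n` the two bounds clash: `|c| n² / 2 ≤ C (1 + n) ≤ 2 C n < |c| n² / 2`.
  obtain ⟨n, hn1, hn2⟩ : ∃ n : ℝ, 1 ≤ n ∧ 4 * C / |c| < n :=
    ⟨max 1 (4 * C / |c| + 1), le_max_left _ _, lt_of_lt_of_le (by linarith) (le_max_right _ _)⟩
  have h1 := h (-n) (by linarith)
  rw [abs_mul, abs_of_pos (Real.exp_pos _), abs_neg, abs_of_pos (by linarith : 0 < n)] at h1
  have h2 := Real.add_one_le_exp ((-n) ^ 2 / 2)
  rw [div_lt_iff₀ hc'] at hn2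
  have hC : 0 ≤ C := by
    have h3 := h 0 le_rfl
    simp at h3
    linarith [abs_nonneg c]
  have h4 : |c| * ((-n) ^ 2 / 2 + 1) ≤ |c| * Real.exp ((-n) ^ 2 / 2) := by gcongr
  nlinarith

/-- On `y < x` the product integral is proportional to `gaussMoment`. -/
theorem productIntegral_proportional {ν : ℝ} (hν : 0 < ν) {x : ℝ} (hx : 0 < x) :
    ∃ c : ℝ, ∀ y : ℝ, y < x → productIntegral ν x y = c * gaussMoment ν y := by
  have hν1 : 0 < ν + 1 := by linarith
  have dH := fun y (hy : y < x) => hasDerivAt_productIntegral hν hy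
  have dH' := fun y (hy : y < x) => by
    have := hasDerivAt_productIntegralDeriv hν hy
    rwa [integral_productIntegrand_second hν hy] at this
  have dh := hasDerivAt_gaussMoment hν
  have dh' := fun y => by
    have := hasDerivAt_gaussMoment hν1 y
    rwa [show ν + 1 + 1 = ν + 2 by ring, gaussMoment_add_two hν] at this
  -- The Wronskian; the common equation gives `W' = y W`, so `W e^(-y²/2)` is constant.
  set W := fun y => productIntegral ν x y * gaussMoment (ν + 1) y -
    productIntegralDeriv ν x y * gaussMoment ν y with hW
  have dW : ∀ y < x, HasDerivAt (fun y => W y * Real.exp (-(y ^ 2 / 2))) 0 y := by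
    intro y hy
    have e : HasDerivAt (fun y : ℝ => Real.exp (-(y ^ 2 / 2)))
        (Real.exp (-(y ^ 2 / 2)) * -(y)) y := by
      refine (((hasDerivAt_id y).pow 2).div_const 2).neg.exp.congr_deriv ?_
      simp
    refine ((((dH y hy).mul (dh' y)).sub ((dH' y hy).mul (dh y))).mul e).congr_deriv ?_
    simp only [Pi.mul_apply, Pi.sub_apply]
    ring
  have cst : ∀ (f : ℝ → ℝ), (∀ y < x, HasDerivAt f 0 y) → ∀ y < x, f y = f 0 := by
    intro f hf y hy
    exact isOpen_Iio.is_const_of_deriv_eq_zero (s := Iio x) isPreconnected_Iio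
      (fun z hz => (hf z hz).differentiableAt.differentiableWithinAt)
      (fun z hz => (hf z hz).deriv) hy hx
  have hWe : ∀ y < x, W y = W 0 * Real.exp (y ^ 2 / 2) := by
    intro y hy
    have := cst _ dW y hy
    rw [Real.exp_neg] at this
    field_simp at this
    simpa [mul_comm] using this
  obtain ⟨C, hC⟩ := abs_productIntegral_le hν hx
  have hW0 : W 0 = 0 := by
    refine eq_zero_of_mul_exp_sq_le (C := C * gaussMoment (ν + 1) 0 + C * gaussMoment ν 0)
      fun y hy => ?_
    rw [← hWe y (by linarith)]
    obtain ⟨b1, b2⟩ := hC y hy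
    have p0 := gaussMoment_pos hν y
    have p1 := gaussMoment_pos hν1 y
    have l0 := gaussMoment_le hν hy
    have l1 := gaussMoment_le hν1 hy
    have hC0 : 0 ≤ C := (abs_nonneg _).trans b1
    calc |W y| ≤ |productIntegral ν x y * gaussMoment (ν + 1) y| +
          |productIntegralDeriv ν x y * gaussMoment ν y| := abs_sub _ _
      _ = |productIntegral ν x y| * gaussMoment (ν + 1) y +
          |productIntegralDeriv ν x y| * gaussMoment ν y := by
        rw [abs_mul, abs_mul, abs_of_pos p0, abs_of_pos p1]
      _ ≤ C * gaussMoment (ν + 1) 0 + C * (1 + |y|) * gaussMoment ν 0 := by gcongr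
      _ ≤ C * gaussMoment (ν + 1) 0 * (1 + |y|) + C * (1 + |y|) * gaussMoment ν 0 := by
        have : 0 ≤ C * gaussMoment (ν + 1) 0 * |y| :=
          mul_nonneg (mul_nonneg hC0 (p1.le.trans l1)) (abs_nonneg y)
        linarith
      _ = _ := by ring
  -- The derivative of `H / h` is `-W / h²`, which is now zero.
  have dq : ∀ y < x, HasDerivAt (fun y => productIntegral ν x y / gaussMoment ν y) 0 y := by
    intro y hy
    have h1 := hWe y hy
    rw [hW0, zero_mul] at h1
    refine ((dH y hy).div (dh y) (gaussMoment_pos hν y).ne').congr_deriv ?_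
    rw [show productIntegralDeriv ν x y * gaussMoment ν y -
      productIntegral ν x y * gaussMoment (ν + 1) y = -(W y) by simp only [hW]; ring, h1]
    simp
  refine ⟨productIntegral ν x 0 / gaussMoment ν 0, fun y hy => ?_⟩
  rw [← cst _ dq y hy, div_mul_cancel₀ _ (gaussMoment_pos hν y).ne']

/-! ### Asymptotics at `-∞` and the constant of proportionality -/

/-- With `y = -1/b`, replacing `s` by `b s` turns `e^(y s)` into `e^(-s)` and the Gaussian into
`e^(-(b s)²/2)`, which tends to `1` and leaves Euler's integral. -/
theorem tendsto_rpow_mul_gaussMoment {ν : ℝ} (hν : 0 < ν) :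
    Tendsto (fun b : ℝ => b ^ (-ν) * gaussMoment ν (-b⁻¹)) (𝓝[>] 0) (𝓝 (Real.Gamma ν)) := by
  have key : Tendsto (fun b : ℝ => ∫ s in Ioi (0 : ℝ),
      s ^ (ν - 1) * Real.exp (-(b * s) ^ 2 / 2) * Real.exp (-s)) (𝓝[>] 0)
      (𝓝 (∫ s in Ioi (0 : ℝ), s ^ (ν - 1) * Real.exp (-(0 * s) ^ 2 / 2) * Real.exp (-s))) := by
    refine tendsto_integral_filter_of_dominated_convergence
      (fun s => Real.exp (-s) * s ^ (ν - 1)) ?_ ?_ (Real.GammaIntegral_convergent hν) ?_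
    · exact Eventually.of_forall fun b => Measurable.aestronglyMeasurable (by fun_prop)
    · refine Eventually.of_forall fun b => ?_
      filter_upwards [ae_restrict_mem measurableSet_Ioi] with s hs
      have hs0 : (0 : ℝ) < s := hs
      rw [Real.norm_of_nonneg (by positivity), mul_comm (Real.exp (-s))]
      have : Real.exp (-(b * s) ^ 2 / 2) ≤ 1 := Real.exp_le_one_iff.2 (by
        nlinarith [sq_nonneg (b * s)])
      gcongr
      exact mul_le_of_le_one_right (by positivity) this
    · refine Eventually.of_forall fun s => ?_
      refine Tendsto.mono_left ?_ nhdsWithin_le_nhds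
      exact (by fun_prop : Continuous fun b : ℝ =>
        s ^ (ν - 1) * Real.exp (-(b * s) ^ 2 / 2) * Real.exp (-s)).tendsto 0
  have hlim : (∫ s in Ioi (0 : ℝ), s ^ (ν - 1) * Real.exp (-(0 * s) ^ 2 / 2) * Real.exp (-s)) =
      Real.Gamma ν := by
    rw [Real.Gamma_eq_integral hν]
    refine setIntegral_congr_fun measurableSet_Ioi fun s _ => ?_
    simp [mul_comm]
  rw [hlim] at key
  refine key.congr' ?_
  filter_upwards [self_mem_nhdsWithin] with b hb
  have hb0 : (0 : ℝ) < b := hb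
  have h := integral_comp_mul_left_Ioi
    (fun s : ℝ => s ^ (ν - 1) * Real.exp (-s ^ 2 / 2) * Real.exp (-b⁻¹ * s)) 0 hb0
  rw [mul_zero, smul_eq_mul] at h
  have h2 : gaussMoment ν (-b⁻¹) = b * ∫ s in Ioi (0 : ℝ), (b * s) ^ (ν - 1) *
      Real.exp (-(b * s) ^ 2 / 2) * Real.exp (-b⁻¹ * (b * s)) := by
    rw [h, gaussMoment]; field_simp
  rw [h2, ← mul_assoc, ← integral_const_mul]
  refine setIntegral_congr_fun measurableSet_Ioi fun s hs => ?_
  have hs0 : (0 : ℝ) < s := hs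
  have e1 : b ^ (-ν) * b * b ^ (ν - 1) = 1 := by
    rw [mul_assoc, ← Real.rpow_one_add' hb0.le (by simpa using hν.ne'), ← Real.rpow_add hb0]
    simp
  have e2 : -b⁻¹ * (b * s) = -s := by field_simp
  simp only [e2, Real.mul_rpow hb0.le hs0.le]
  linear_combination (-(s ^ (ν - 1) * Real.exp (-(b * s) ^ 2 / 2) * Real.exp (-s))) * e1

/-- With `y = -1/b` and `t = (b s)²`, the term `-y² t / 2` becomes `-s²/2` and the cross term tends
to `-x s`, so a Gaussian moment at `-x` appears in the limit; the factor `2` comes from `dt = 2 b² s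
ds`. -/
theorem tendsto_rpow_mul_productIntegral {ν : ℝ} (hν : 0 < ν) {x : ℝ} (hx : 0 < x) :
    Tendsto (fun b : ℝ => b ^ (-ν) * productIntegral ν x (-b⁻¹)) (𝓝[>] 0)
      (𝓝 (2 * gaussMoment ν (-x))) := by
  -- The integrand after the substitution, with `b ^ (-ν)` absorbed; in this form `b = 0` is
  -- allowed.
  set F : ℝ → ℝ → ℝ := fun b s => 2 * (s ^ (ν - 1) * (1 + (b * s) ^ 2) ^ (-(ν + 1) / 2) *
    Real.exp (-s ^ 2 / 2 - (x * b * s) ^ 2 / 2 - x * s * √(1 + (b * s) ^ 2))) with hF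
  have key : Tendsto (fun b : ℝ => ∫ s in Ioi (0 : ℝ), F b s) (𝓝[>] 0)
      (𝓝 (∫ s in Ioi (0 : ℝ), F 0 s)) := by
    refine tendsto_integral_filter_of_dominated_convergence
      (fun s => 2 * (s ^ (ν - 1) * Real.exp (-s ^ 2 / 2) * Real.exp (0 * s))) ?_ ?_
      ((integrableOn_rpow_mul_gauss_mul_exp hν 0).const_mul 2) ?_
    · exact Eventually.of_forall fun b => Measurable.aestronglyMeasurable (by
        simp only [hF]; fun_prop)
    · refine Eventually.of_forall fun b => ?_
      filter_upwards [ae_restrict_mem measurableSet_Ioi] with s hs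
      have hs0 : (0 : ℝ) < s := hs
      simp only [hF]
      rw [Real.norm_of_nonneg (by positivity), zero_mul, Real.exp_zero, mul_one]
      have h1 : (1 + (b * s) ^ 2) ^ (-(ν + 1) / 2) ≤ 1 :=
        Real.rpow_le_one_of_one_le_of_nonpos (by nlinarith [sq_nonneg (b * s)]) (by linarith)
      have h2 : -s ^ 2 / 2 - (x * b * s) ^ 2 / 2 - x * s * √(1 + (b * s) ^ 2) ≤ -s ^ 2 / 2 := by
        have : 0 ≤ x * s * √(1 + (b * s) ^ 2) := by positivity
        nlinarith [sq_nonneg (x * b * s)]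
      gcongr
      exact mul_le_of_le_one_right (by positivity) h1
    · refine Eventually.of_forall fun s => ?_
      refine Tendsto.mono_left ?_ nhdsWithin_le_nhds
      have : Continuous fun b : ℝ => F b s := by
        simp only [hF]
        refine continuous_const.mul ((continuous_const.mul
          (Continuous.rpow_const (by fun_prop) fun b => Or.inl ?_)).mul (by fun_prop))
        positivity
      exact this.tendsto 0
  have hlim : (∫ s in Ioi (0 : ℝ), F 0 s) = 2 * gaussMoment ν (-x) := by
    rw [gaussMoment, ← integral_const_mul]
    refine setIntegral_congr_fun measurableSet_Ioi fun s _ => ?_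
    simp only [hF]
    rw [mul_assoc (s ^ (ν - 1)) (Real.exp _), ← Real.exp_add]
    simp [sub_eq_add_neg]
  rw [hlim] at key
  refine key.congr' ?_
  filter_upwards [self_mem_nhdsWithin] with b hb
  have hb0 : (0 : ℝ) < b := hb
  set g := fun t : ℝ => productWeight ν t * Real.exp (productExponent x (-b⁻¹) t) with hg
  have h1 := integral_comp_rpow_Ioi g (p := 2) (by norm_num)
  have h := integral_comp_mul_left_Ioi (fun s : ℝ => (|2| * s ^ ((2 : ℝ) - 1)) • g (s ^ (2 : ℝ)))
    0 hb0
  rw [mul_zero, smul_eq_mul, h1] at h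
  have h2 : productIntegral ν x (-b⁻¹) = b * ∫ s in Ioi (0 : ℝ),
      (|2| * (b * s) ^ ((2 : ℝ) - 1)) • g ((b * s) ^ (2 : ℝ)) := by
    rw [h, ← mul_assoc, mul_inv_cancel₀ hb0.ne', one_mul, productIntegral]
  rw [h2, ← mul_assoc, ← integral_const_mul]
  refine setIntegral_congr_fun measurableSet_Ioi fun s hs => ?_
  have hs0 : (0 : ℝ) < s := hs
  have hbs : 0 < b * s := by positivity
  have e1 : b ^ (-ν) * b * b ^ (ν - 1) = 1 := by
    rw [mul_assoc, ← Real.rpow_one_add' hb0.le (by simpa using hν.ne'), ← Real.rpow_add hb0]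
    simp
  have e2 : ((b * s) ^ 2) ^ (ν / 2 - 1) * (b * s) = b ^ (ν - 1) * s ^ (ν - 1) := by
    rw [← Real.rpow_two, ← Real.rpow_mul hbs.le, ← Real.mul_rpow hb0.le hs0.le,
      ← Real.rpow_add_one hbs.ne']
    congr 1; ring
  have e3 : productExponent x (-b⁻¹) ((b * s) ^ 2) =
      -s ^ 2 / 2 - (x * b * s) ^ 2 / 2 - x * s * √(1 + (b * s) ^ 2) := by
    unfold productExponent
    rw [Real.sqrt_mul (by positivity), Real.sqrt_sq hbs.le, add_comm ((b * s) ^ 2)]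
    field_simp
    ring
  simp only [hF, hg, Real.rpow_two, productWeight, e3, smul_eq_mul, abs_two]
  rw [show (2 : ℝ) - 1 = 1 by norm_num, Real.rpow_one]
  generalize (1 + (b * s) ^ 2) ^ (-(ν + 1) / 2) = U
  generalize Real.exp _ = E
  generalize ((b * s) ^ 2) ^ (ν / 2 - 1) = V at *
  linear_combination (-2 * s ^ (ν - 1) * U * E) * e1 - (b ^ (-ν) * b * 2 * U * E) * e2

theorem Gamma_mul_productIntegral {ν : ℝ} (hν : 0 < ν) {x y : ℝ} (hx : 0 < x) (hxy : y < x) :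
    Real.Gamma ν * productIntegral ν x y = 2 * gaussMoment ν (-x) * gaussMoment ν y := by
  obtain ⟨c, hc⟩ := productIntegral_proportional hν hx
  have h1 := (tendsto_rpow_mul_gaussMoment hν).const_mul c
  have h2 := tendsto_rpow_mul_productIntegral hν hx
  have h3 : c * Real.Gamma ν = 2 * gaussMoment ν (-x) := by
    refine tendsto_nhds_unique h1 (h2.congr' ?_)
    filter_upwards [self_mem_nhdsWithin] with b hb
    have hb0 : (0 : ℝ) < b := hb
    have : -b⁻¹ < x := by
      have := inv_pos.2 hb0
      linarith
    rw [hc _ this]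
    ring
  rw [hc y hxy, ← h3]
  ring

/-! ### Principal square roots and the identity theorem on the right half-plane -/

theorem Complex.sqrt_pow_two (w : ℂ) : Complex.sqrt w ^ 2 = w := by
  simp [Complex.sqrt]

theorem Complex.sqrt_re (w : ℂ) : (Complex.sqrt w).re = √((‖w‖ + w.re) / 2) :=
  Complex.cpow_inv_two_re w

theorem Complex.sqrt_re_pos {w : ℂ} (hw : 0 < w.re) : 0 < (Complex.sqrt w).re := by
  rw [Complex.sqrt_re]
  positivity

theorem Complex.sqrt_eq_of_sq_eq {w r : ℂ} (hr : 0 < r.re) (h : r ^ 2 = w) :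
    Complex.sqrt w = r := by
  rcases sq_eq_sq_iff_eq_or_eq_neg.1 ((Complex.sqrt_pow_two w).trans h.symm) with h1 | h1
  · exact h1
  · have h2 : 0 ≤ (Complex.sqrt w).re := by rw [Complex.sqrt_re]; positivity
    rw [h1, Complex.neg_re] at h2
    linarith

/-- Each factor has argument strictly between `-π/4` and `π/4`, so the product stays in the right
half-plane. -/
theorem Complex.mul_re_pos_of_sq_re_pos {p q : ℂ} (hp : 0 < p.re) (hq : 0 < q.re)
    (hp2 : 0 < (p ^ 2).re) (hq2 : 0 < (q ^ 2).re) : 0 < (p * q).re := by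
  simp only [sq, Complex.mul_re] at *
  have h1 : |p.im| < p.re := abs_lt_of_sq_lt_sq (by nlinarith) hp.le
  have h2 : |q.im| < q.re := abs_lt_of_sq_lt_sq (by nlinarith) hq.le
  have h3 : |p.im| * |q.im| < p.re * q.re := mul_lt_mul'' h1 h2 (abs_nonneg _) (abs_nonneg _)
  have h4 := le_abs_self (p.im * q.im)
  rw [abs_mul] at h4
  linarith

theorem Complex.sqrt_re_lt_sqrt_re {w z : ℂ} (hw : 0 < w.re) (him : w.im = z.im)
    (hre : w.re < z.re) : (Complex.sqrt w).re < (Complex.sqrt z).re := by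
  rw [Complex.sqrt_re, Complex.sqrt_re]
  have h1 : ‖w‖ ≤ ‖z‖ := by
    rw [Complex.norm_def, Complex.norm_def]
    refine Real.sqrt_le_sqrt ?_
    rw [Complex.normSq_apply, Complex.normSq_apply, him]
    nlinarith
  exact Real.sqrt_lt_sqrt (by positivity) (by linarith)

/-- Functions holomorphic on the right half-plane that agree on the positive reals are equal. -/
theorem eqOn_re_pos_of_forall_ofReal_pos {f g : ℂ → ℂ}
    (hf : DifferentiableOn ℂ f {z | 0 < z.re}) (hg : DifferentiableOn ℂ g {z | 0 < z.re})
    (h : ∀ r : ℝ, 0 < r → f r = g r) {z : ℂ} (hz : 0 < z.re) : f z = g z := by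
  have ho : IsOpen {z : ℂ | 0 < z.re} := isOpen_lt continuous_const Complex.continuous_re
  refine (hf.analyticOnNhd ho).eqOn_of_preconnected_of_frequently_eq (hg.analyticOnNhd ho)
    (convex_halfSpace_re_gt 0).isPreconnected (z₀ := 1) (by simp) ?_ hz
  have ht : Tendsto (fun r : ℝ => (r : ℂ)) (𝓝[≠] 1) (𝓝[≠] 1) := by
    refine tendsto_nhdsWithin_iff.2 ⟨?_, ?_⟩
    · refine Tendsto.mono_left ?_ nhdsWithin_le_nhds
      simpa using Complex.continuous_ofReal.tendsto (1 : ℝ)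
    · filter_upwards [self_mem_nhdsWithin] with r hr
      simpa using hr
  refine ht.frequently (Eventually.frequently ?_)
  filter_upwards [nhdsWithin_le_nhds (lt_mem_nhds (zero_lt_one' ℝ))] with r hr
  exact h r hr

/-- The change of variables from `A = a + b`, `B = a - b` to `x`, `y`, where `x² + y² = 2a` and `x y
= b`. -/
theorem exists_sq_add_sq_eq_add {A B : ℝ} (hA : 0 < A) (hB : 0 < B) :
    0 < (√A + √B) / √2 ∧ (√A - √B) / √2 < (√A + √B) / √2 ∧
    ((√A + √B) / √2) ^ 2 + ((√A - √B) / √2) ^ 2 = A + B ∧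
    ((√A + √B) / √2) * ((√A - √B) / √2) = (A - B) / 2 := by
  have hA' := Real.sqrt_pos.2 hA
  have hB' := Real.sqrt_pos.2 hB
  have h2 : √2 ^ 2 = (2 : ℝ) := Real.sq_sqrt (by norm_num)
  have hA2 := Real.sq_sqrt hA.le
  have hB2 := Real.sq_sqrt hB.le
  refine ⟨by positivity, by gcongr; linarith, ?_, ?_⟩
  · rw [div_pow, div_pow, h2]; linear_combination hA2 + hB2
  · rw [div_mul_div_comm, ← sq, h2]; linear_combination (hA2 - hB2) / 2

/-! ### The Laplace transform and its analytic continuation -/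

theorem laplaceIntegrand_eq (ν : ℝ) (a b : ℂ) (t : ℝ) :
    laplaceIntegrand ν a b t = (productWeight ν t : ℂ) *
      Complex.exp (-a * t + b * ((√(t * (t + 1)) : ℝ) : ℂ)) := rfl

theorem measurable_laplaceIntegrand (ν : ℝ) (a b : ℂ) : Measurable (laplaceIntegrand ν a b) := by
  have := measurable_productWeight ν
  have : laplaceIntegrand ν a b = fun t => (productWeight ν t : ℂ) *
      Complex.exp (-a * t + b * ((√(t * (t + 1)) : ℝ) : ℂ)) := rfl
  rw [this]
  fun_prop

theorem integrableOn_productWeight_mul_exp {ν : ℝ} (hν : 0 < ν) {α β : ℝ} (h₁ : 0 < α + β)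
    (h₂ : 0 < α - β) :
    IntegrableOn (fun t => productWeight ν t * Real.exp (-α * t + β * √(t * (t + 1))))
      (Ioi 0) := by
  obtain ⟨-, h3, h4, h5⟩ := exists_sq_add_sq_eq_add h₁ h₂
  have h := integrableOn_productIntegrand hν h3 (k := 0) (M := 1) (q := fun _ => 1)
    (by fun_prop) (by simp)
  refine h.congr_fun (fun t _ => ?_) measurableSet_Ioi
  simp only [productExponent, h4, h5, one_mul]
  ring_nf

theorem norm_laplaceIntegrand (ν : ℝ) (a b : ℂ) {t : ℝ} (ht : 0 < t) :
    ‖laplaceIntegrand ν a b t‖ =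
      productWeight ν t * Real.exp (-a.re * t + b.re * √(t * (t + 1))) := by
  rw [laplaceIntegrand_eq, norm_mul, Complex.norm_real,
    Real.norm_of_nonneg (productWeight_nonneg ν ht.le), Complex.norm_exp]
  simp

theorem integrableOn_laplaceIntegrand {ν : ℝ} (hν : 0 < ν) {a b : ℂ} (h₁ : 0 < a.re + b.re)
    (h₂ : 0 < a.re - b.re) : IntegrableOn (laplaceIntegrand ν a b) (Ioi 0) := by
  refine (integrableOn_productWeight_mul_exp hν h₁ h₂).mono'
    (measurable_laplaceIntegrand ν a b).aestronglyMeasurable ?_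
  filter_upwards [ae_restrict_mem measurableSet_Ioi] with t ht
  exact (norm_laplaceIntegrand ν a b ht).le

/-- `A` enters only through `exp (A (√(t (t + 1)) - t) / 2)`, so this is a Laplace transform in `A`.
In the next lemma `B` enters through `exp (-B (√(t (t + 1)) + t) / 2)`. -/
theorem differentiableAt_integral_laplaceIntegrand_add {ν : ℝ} (hν : 0 < ν) {A B : ℂ}
    (hA : 0 < A.re) (hB : 0 < B.re) :
    DifferentiableAt ℂ
      (fun A => ∫ t in Ioi 0, laplaceIntegrand ν ((A + B) / 2) ((A - B) / 2) t) A := by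
  have hi : ∀ c : ℝ, 0 < c → IntegrableOn (fun t : ℝ =>
      ‖laplaceIntegrand ν (B / 2) (-B / 2) t‖ * Real.exp (c * ((√(t * (t + 1)) - t) / 2)))
      (Ioi 0) := by
    intro c hc
    refine (integrableOn_productWeight_mul_exp hν (α := (c + B.re) / 2) (β := (c - B.re) / 2)
      (by linarith) (by linarith)).congr_fun (fun t ht => ?_) measurableSet_Ioi
    simp only [norm_laplaceIntegrand ν _ _ ht, mul_assoc, ← Real.exp_add]
    congr 2
    simp
    ring
  have h := differentiableAt_integral_mul_exp (μ := volume.restrict (Ioi (0 : ℝ)))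
    (f := laplaceIntegrand ν (B / 2) (-B / 2)) (z₀ := A) (X := fun t => (√(t * (t + 1)) - t) / 2)
    (measurable_laplaceIntegrand ν _ _).aestronglyMeasurable
    (Measurable.aestronglyMeasurable (by fun_prop)) (half_pos hA)
    (hi _ (by linarith)) (hi _ (by linarith))
  refine h.congr_of_eventuallyEq (Eventually.of_forall fun z => ?_)
  refine setIntegral_congr_fun measurableSet_Ioi fun t _ => ?_
  simp only [laplaceIntegrand_eq, mul_assoc, ← Complex.exp_add]
  congr 2
  push_cast
  ring

theorem differentiableAt_integral_laplaceIntegrand_sub {ν : ℝ} (hν : 0 < ν) {A B : ℂ}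
    (hA : 0 < A.re) (hB : 0 < B.re) :
    DifferentiableAt ℂ
      (fun B => ∫ t in Ioi 0, laplaceIntegrand ν ((A + B) / 2) ((A - B) / 2) t) B := by
  have hi : ∀ c : ℝ, 0 < c → IntegrableOn (fun t : ℝ =>
      ‖laplaceIntegrand ν (A / 2) (A / 2) t‖ * Real.exp (c * (-(√(t * (t + 1)) + t) / 2)))
      (Ioi 0) := by
    intro c hc
    refine (integrableOn_productWeight_mul_exp hν (α := (A.re + c) / 2) (β := (A.re - c) / 2)
      (by linarith) (by linarith)).congr_fun (fun t ht => ?_) measurableSet_Ioi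
    simp only [norm_laplaceIntegrand ν _ _ ht, mul_assoc, ← Real.exp_add]
    congr 2
    simp
    ring
  have h := differentiableAt_integral_mul_exp (μ := volume.restrict (Ioi (0 : ℝ)))
    (f := laplaceIntegrand ν (A / 2) (A / 2)) (z₀ := B) (X := fun t => -(√(t * (t + 1)) + t) / 2)
    (measurable_laplaceIntegrand ν _ _).aestronglyMeasurable
    (Measurable.aestronglyMeasurable (by fun_prop)) (half_pos hB)
    (hi _ (by linarith)) (hi _ (by linarith))
  refine h.congr_of_eventuallyEq (Eventually.of_forall fun z => ?_)
  refine setIntegral_congr_fun measurableSet_Ioi fun t _ => ?_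
  simp only [laplaceIntegrand_eq, mul_assoc, ← Complex.exp_add]
  congr 2
  push_cast
  ring

/-- The product formula for real arguments with `0 < x` and `y < x`. -/
theorem parabolicCylinderD_mul_parabolicCylinderD {ν : ℝ} (hν : 0 < ν) {x y : ℝ} (hx : 0 < x)
    (hxy : y < x) :
    parabolicCylinderD (-(ν : ℂ)) (x : ℂ) * parabolicCylinderD (-(ν : ℂ)) (-(y : ℂ)) =
      ((Real.exp (-(x ^ 2 + y ^ 2) / 4) / (2 * Real.Gamma ν) * productIntegral ν x y : ℝ) : ℂ) := by
  have h := Gamma_mul_productIntegral hν hx hxy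
  have hΓ := Real.Gamma_pos_of_pos hν
  have h1 : gaussMoment ν (-x) * gaussMoment ν y = Real.Gamma ν * productIntegral ν x y / 2 := by
    linarith
  rw [parabolicCylinderD_neg_eq hν, parabolicCylinderD_neg_eq hν, ← Complex.ofReal_neg,
    gaussLaplace_ofReal, gaussLaplace_ofReal, neg_neg, Complex.Gamma_ofReal]
  have e1 : Complex.exp (-(x : ℂ) ^ 2 / 4) = ((Real.exp (-x ^ 2 / 4) : ℝ) : ℂ) := by push_cast; rfl
  have e2 : Complex.exp (-((-y : ℝ) : ℂ) ^ 2 / 4) = ((Real.exp (-y ^ 2 / 4) : ℝ) : ℂ) := by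
    push_cast; rw [neg_sq]
  have e3 : Real.exp (-(x ^ 2 + y ^ 2) / 4) = Real.exp (-x ^ 2 / 4) * Real.exp (-y ^ 2 / 4) := by
    rw [← Real.exp_add]; congr 1; ring
  rw [e1, e2, e3]
  norm_cast
  rw [show Real.exp (-x ^ 2 / 4) / Real.Gamma ν * gaussMoment ν (-x) *
      (Real.exp (-y ^ 2 / 4) / Real.Gamma ν * gaussMoment ν y) =
      Real.exp (-x ^ 2 / 4) / Real.Gamma ν * (Real.exp (-y ^ 2 / 4) / Real.Gamma ν) *
        (gaussMoment ν (-x) * gaussMoment ν y) by ring, h1]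
  field_simp

/-- The Laplace transform, in terms of `A = a + b` and `B = a - b`. -/
theorem integral_laplaceIntegrand {ν : ℝ} (hν : 0 < ν) {A B : ℂ} (hA : 0 < A.re)
    (hB : 0 < B.re) :
    ∫ t in Ioi 0, laplaceIntegrand ν ((A + B) / 2) ((A - B) / 2) t =
      2 * Complex.exp ((A + B) / 4) * Complex.Gamma ν *
        parabolicCylinderD (-(ν : ℂ)) ((Complex.sqrt A + Complex.sqrt B) / (√2 : ℝ)) *
        parabolicCylinderD (-(ν : ℂ)) (-((Complex.sqrt A - Complex.sqrt B) / (√2 : ℝ))) := by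
  have hD := differentiable_parabolicCylinderD_neg hν
  have hs : ∀ z : ℂ, 0 < z.re → DifferentiableAt ℂ Complex.sqrt z := fun z hz =>
    (Complex.hasDerivAt_sqrt (Or.inl hz)).differentiableAt
  -- Continuation in `A` with `B` real; the final step fixes a complex `A` and continues in `B`.
  have key : ∀ B : ℝ, 0 < B → ∀ A : ℂ, 0 < A.re →
      ∫ t in Ioi 0, laplaceIntegrand ν ((A + B) / 2) ((A - B) / 2) t =
      2 * Complex.exp ((A + B) / 4) * Complex.Gamma ν *
        parabolicCylinderD (-(ν : ℂ)) ((Complex.sqrt A + Complex.sqrt B) / (√2 : ℝ)) *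
        parabolicCylinderD (-(ν : ℂ)) (-((Complex.sqrt A - Complex.sqrt B) / (√2 : ℝ))) := by
    intro B hB A hA
    refine eqOn_re_pos_of_forall_ofReal_pos (f := fun A : ℂ =>
      ∫ t in Ioi 0, laplaceIntegrand ν ((A + B) / 2) ((A - B) / 2) t) (g := fun A : ℂ =>
      2 * Complex.exp ((A + B) / 4) * Complex.Gamma ν *
        parabolicCylinderD (-(ν : ℂ)) ((Complex.sqrt A + Complex.sqrt B) / (√2 : ℝ)) *
        parabolicCylinderD (-(ν : ℂ)) (-((Complex.sqrt A - Complex.sqrt B) / (√2 : ℝ))))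
      ?_ ?_ ?_ hA
    · exact fun z hz => (differentiableAt_integral_laplaceIntegrand_add hν hz
        (by simpa using hB)).differentiableWithinAt
    · intro z hz
      have h1 := hs z hz
      exact DifferentiableAt.differentiableWithinAt (by fun_prop)
    · intro A hA
      obtain ⟨p1, p2, p3, p4⟩ := exists_sq_add_sq_eq_add hA hB
      have h := parabolicCylinderD_mul_parabolicCylinderD hν p1 p2
      rw [p3] at h
      have sA : Complex.sqrt (A : ℂ) = (√A : ℝ) := by
        rw [Complex.sqrt_of_nonneg (by exact_mod_cast hA.le), Complex.ofReal_re]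
      have sB : Complex.sqrt (B : ℂ) = (√B : ℝ) := by
        rw [Complex.sqrt_of_nonneg (by exact_mod_cast hB.le), Complex.ofReal_re]
      have hI : ∫ t in Ioi 0, laplaceIntegrand ν (((A : ℂ) + B) / 2) ((A - B) / 2) t =
          (productIntegral ν ((√A + √B) / √2) ((√A - √B) / √2) : ℂ) := by
        rw [productIntegral, ← integral_complex_ofReal]
        refine setIntegral_congr_fun measurableSet_Ioi fun t _ => ?_
        simp only [laplaceIntegrand_eq, productExponent, p3, p4]
        push_cast
        congr 2
        ring
      have e : Real.exp (-(A + B) / 4) * Real.exp ((A + B) / 4) = 1 := by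
        rw [← Real.exp_add, ← Real.exp_zero]; congr 1; ring
      have e' := congrArg (fun r : ℝ => (r : ℂ)) e
      have hΓ : Complex.Gamma ν ≠ 0 := Complex.Gamma_ne_zero_of_re_pos (by simpa using hν)
      rw [hI, sA, sB, mul_assoc (_ * _)]
      push_cast [← Complex.Gamma_ofReal] at h e' ⊢
      rw [h]
      generalize Complex.exp (-((A : ℂ) + B) / 4) = E at *
      field_simp
      linear_combination
        (-(productIntegral ν ((√A + √B) / √2) ((√A - √B) / √2) : ℂ)) * e'
  refine eqOn_re_pos_of_forall_ofReal_pos (f := fun B : ℂ =>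
      ∫ t in Ioi 0, laplaceIntegrand ν ((A + B) / 2) ((A - B) / 2) t) (g := fun B : ℂ =>
      2 * Complex.exp ((A + B) / 4) * Complex.Gamma ν *
        parabolicCylinderD (-(ν : ℂ)) ((Complex.sqrt A + Complex.sqrt B) / (√2 : ℝ)) *
        parabolicCylinderD (-(ν : ℂ)) (-((Complex.sqrt A - Complex.sqrt B) / (√2 : ℝ))))
      ?_ ?_ (fun r hr => key r hr A hA) hB
  · exact fun z hz =>
      (differentiableAt_integral_laplaceIntegrand_sub hν hA hz).differentiableWithinAt
  · intro z hz
    have h1 := hs z hz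
    exact DifferentiableAt.differentiableWithinAt (by fun_prop)

/-! ### Identification of the nested roots -/

theorem sqrt_sq_sub_sq {a b : ℂ} (h₁ : 0 < (a + b).re) (h₂ : 0 < (a - b).re) :
    Complex.sqrt (a ^ 2 - b ^ 2) = Complex.sqrt (a + b) * Complex.sqrt (a - b) := by
  refine Complex.sqrt_eq_of_sq_eq (Complex.mul_re_pos_of_sq_re_pos (Complex.sqrt_re_pos h₁)
    (Complex.sqrt_re_pos h₂) ?_ ?_) ?_
  · rwa [Complex.sqrt_pow_two]
  · rwa [Complex.sqrt_pow_two]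
  · rw [mul_pow, Complex.sqrt_pow_two, Complex.sqrt_pow_two]; ring

theorem ofReal_sqrt_two_sq : (((√2 : ℝ) : ℂ)) ^ 2 = 2 := by
  exact_mod_cast congrArg (fun r : ℝ => (r : ℂ)) (Real.sq_sqrt (show (0 : ℝ) ≤ 2 by norm_num))

theorem sqrt_add_sqrt_sq_sub_sq {a b : ℂ} (h₁ : 0 < (a + b).re) (h₂ : 0 < (a - b).re) :
    Complex.sqrt (a + Complex.sqrt (a ^ 2 - b ^ 2)) =
      (Complex.sqrt (a + b) + Complex.sqrt (a - b)) / (√2 : ℝ) := by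
  rw [sqrt_sq_sub_sq h₁ h₂]
  refine Complex.sqrt_eq_of_sq_eq ?_ ?_
  · rw [Complex.div_ofReal_re, Complex.add_re]
    have := Complex.sqrt_re_pos h₁
    have := Complex.sqrt_re_pos h₂
    positivity
  · rw [div_pow, ofReal_sqrt_two_sq]
    linear_combination (Complex.sqrt_pow_two (a + b) + Complex.sqrt_pow_two (a - b)) / 2

/-- Only the square is determined here: `√(a + b) - √(a - b)` may have negative real part, so it
need not be a principal root. -/
theorem half_sub_sqrt_sq {a b : ℂ} (h₁ : 0 < (a + b).re) (h₂ : 0 < (a - b).re) :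
    ((Complex.sqrt (a + b) - Complex.sqrt (a - b)) / (√2 : ℝ)) ^ 2 =
      a - Complex.sqrt (a ^ 2 - b ^ 2) := by
  rw [sqrt_sq_sub_sq h₁ h₂, div_pow, ofReal_sqrt_two_sq]
  linear_combination (Complex.sqrt_pow_two (a + b) + Complex.sqrt_pow_two (a - b)) / 2

theorem integral_laplaceIntegrand_eq {ν : ℝ} (hν : 0 < ν) {a b : ℂ} (h₁ : 0 < (a + b).re)
    (h₂ : 0 < (a - b).re) :
    ∫ t in Ioi (0 : ℝ), laplaceIntegrand ν a b t =
      2 * Complex.exp (a / 2) * Complex.Gamma (ν : ℂ) *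
        parabolicCylinderD (-(ν : ℂ)) (Complex.sqrt (a + Complex.sqrt (a ^ 2 - b ^ 2))) *
        parabolicCylinderD (-(ν : ℂ))
          (-((Complex.sqrt (a + b) - Complex.sqrt (a - b)) / (√2 : ℝ))) := by
  have h := integral_laplaceIntegrand hν h₁ h₂
  rw [show (a + b + (a - b)) / 2 = a by ring, show (a + b - (a - b)) / 2 = b by ring,
    show (a + b + (a - b)) / 4 = a / 2 by ring] at h
  rw [h, sqrt_add_sqrt_sq_sub_sq h₁ h₂]

theorem mainTheorem1 (ν : ℝ) (hν : 0 < ν) :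
    -- the product formula
    (∀ x y : ℝ, 0 < y → y < x →
      IntegrableOn (fun t : ℝ => t ^ (ν / 2 - 1) * (1 + t) ^ (-(ν + 1) / 2) *
          Real.exp (-(x ^ 2 + y ^ 2) * t / 2 + x * y * √(t * (t + 1)))) (Ioi 0) ∧
      parabolicCylinderD (-(ν : ℂ)) (x : ℂ) * parabolicCylinderD (-(ν : ℂ)) (-(y : ℂ)) =
        ((Real.exp (-(x ^ 2 + y ^ 2) / 4) / (2 * Real.Gamma ν) *
          ∫ t in Ioi (0 : ℝ), t ^ (ν / 2 - 1) * (1 + t) ^ (-(ν + 1) / 2) *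
            Real.exp (-(x ^ 2 + y ^ 2) * t / 2 + x * y * √(t * (t + 1))) : ℝ) : ℂ)) ∧
    -- the Laplace transform form: the principal root `√(a - √(a² - b²))`, or its negative, is
    -- taken so that its product with `√(a + √(a² - b²))` is `b`
    (∀ a b : ℂ, 0 < b.re → b.re < a.re →
      IntegrableOn (laplaceIntegrand ν a b) (Ioi 0) ∧
      ∃ y : ℂ, (y = Complex.sqrt (a - Complex.sqrt (a ^ 2 - b ^ 2)) ∨
          y = -Complex.sqrt (a - Complex.sqrt (a ^ 2 - b ^ 2))) ∧
        Complex.sqrt (a + Complex.sqrt (a ^ 2 - b ^ 2)) * y = b ∧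
        ∫ t in Ioi (0 : ℝ), laplaceIntegrand ν a b t =
          2 * Complex.exp (a / 2) * Complex.Gamma (ν : ℂ) *
            parabolicCylinderD (-(ν : ℂ)) (Complex.sqrt (a + Complex.sqrt (a ^ 2 - b ^ 2))) *
            parabolicCylinderD (-(ν : ℂ)) (-y)) ∧
    -- for real `b` both roots are the principal ones
    (∀ (a : ℂ) (b : ℝ), 0 < b → b < a.re →
      ∫ t in Ioi (0 : ℝ), laplaceIntegrand ν a (b : ℂ) t =
        2 * Complex.exp (a / 2) * Complex.Gamma (ν : ℂ) *
          parabolicCylinderD (-(ν : ℂ))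
            (Complex.sqrt (a + Complex.sqrt (a ^ 2 - (b : ℂ) ^ 2))) *
          parabolicCylinderD (-(ν : ℂ))
            (-Complex.sqrt (a - Complex.sqrt (a ^ 2 - (b : ℂ) ^ 2)))) := by
  refine ⟨fun x y hy hxy => ⟨?_, ?_⟩, fun a b hb hab => ⟨?_, ?_⟩, fun a b hb hab => ?_⟩
  · have h := integrableOn_productIntegrand hν hxy (k := 0) (M := 1) (q := fun _ => 1)
      (by fun_prop) (by simp)
    simp only [one_mul] at h
    exact h
  · exact parabolicCylinderD_mul_parabolicCylinderD hν (hy.trans hxy) hxy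
  · exact integrableOn_laplaceIntegrand hν (by linarith) (by linarith)
  · have h₁ : 0 < (a + b).re := by rw [Complex.add_re]; linarith
    have h₂ : 0 < (a - b).re := by rw [Complex.sub_re]; linarith
    refine ⟨(Complex.sqrt (a + b) - Complex.sqrt (a - b)) / (√2 : ℝ), ?_, ?_,
      integral_laplaceIntegrand_eq hν h₁ h₂⟩
    · exact sq_eq_sq_iff_eq_or_eq_neg.1
        ((half_sub_sqrt_sq h₁ h₂).trans (Complex.sqrt_pow_two _).symm)
    · rw [sqrt_add_sqrt_sq_sub_sq h₁ h₂, div_mul_div_comm, ← sq, ofReal_sqrt_two_sq]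
      linear_combination (Complex.sqrt_pow_two (a + b) - Complex.sqrt_pow_two (a - b)) / 2
  · have h₁ : 0 < (a + b).re := by rw [Complex.add_re, Complex.ofReal_re]; linarith
    have h₂ : 0 < (a - b).re := by rw [Complex.sub_re, Complex.ofReal_re]; linarith
    -- For real `b > 0` the numbers `a + b` and `a - b` have equal imaginary parts and `a + b` has
    -- the larger real part, so its root does too; this makes the second root principal.
    have hre : 0 < ((Complex.sqrt (a + b) - Complex.sqrt (a - b)) / (√2 : ℝ)).re := by
      have := Complex.sqrt_re_lt_sqrt_re h₂ (z := a + b) (by simp) (by simp; linarith)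
      rw [Complex.div_ofReal_re, Complex.sub_re]
      exact div_pos (by linarith) (by positivity)
    rw [integral_laplaceIntegrand_eq hν h₁ h₂,
      Complex.sqrt_eq_of_sq_eq hre (half_sub_sqrt_sq h₁ h₂)]
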